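/- Let $d\ge 3$ be an integer and $R>0$. Let $[{\bf x},{\bf y}]=x_0y_0-x_1y_1-\cdots-x_dy_d$ on ${\bf R}^{d+1}$ and let ${\bf H}_R^d=\{{\bf x}:[{\bf x},{\bf x}]=R^2,\ x_0>0\}$ be the hyperboloid model of hyperbolic space. For ${\bf x}\ne{\bf x}'$ in ${\bf H}_R^d$ let $${\mathcal H}_R^d({\bf x},{\bf x}')=\frac{\Gamma(d/2)}{2\pi^{d/2}R^{d-2}}\int_\rho^\infty\frac{dt}{\sinh^{d-1}t},\qquad \rho=\cosh^{-1}\bigl([{\bf x}/R,{\bf x}'/R]\bigr),$$ be the spherically symmetric fundamental solution of $-\Delta$ on ${\bf H}_R^d$ ($\Delta$ the Laplace-Beltrami operator). Write the two points in geodesic polar coordinates, ${\bf x}=(R\cosh r,\,R\sinh r\,\omega)$ and ${\bf x}'=(R\cosh r',\,R\sinh r'\,\omega')$, with $r,r'>0$ and $\omega,\omega'$ in the unit sphere ${\bf S}^{d-1}\subset{\bf R}^d$, and let $\gamma\in[0,\pi]$ be the angle between $\omega$ and $\omega'$. Assume $r\ne r'$ and put $r_<=\min(r,r')$, $r_>=\max(r,r')$.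 Then $${\mathcal H}_R^d({\bf x},{\bf x}')=\frac{\Gamma(d/2)\,e^{-i\pi(d/2-1)}}{2\pi^{d/2}R^{d-2}(d-2)(\sinh r\sinh r')^{d/2-1}}\sum_{l=0}^\infty(-1)^l(2l+d-2)\,P_{d/2-1}^{-(d/2-1+l)}(\cosh r_<)\,Q_{d/2-1}^{d/2-1+l}(\cosh r_>)\,C_l^{d/2-1}(\cos\gamma),$$ where the series converges absolutely. Here, for $z>1$, $P_\nu^\mu$ and $Q_\nu^\mu$ are the associated Legendre functions $$P_\nu^\mu(z)=\frac{1}{\Gamma(1-\mu)}\Bigl(\frac{z+1}{z-1}\Bigr)^{\mu/2}{}_2F_1\Bigl(-\nu,\nu+1;1-\mu;\frac{1-z}{2}\Bigr),$$ $$Q_\nu^\mu(z)=e^{i\pi\mu}\,\frac{\sqrt{\pi}\,\Gamma(\nu+\mu+1)\,(z^2-1)^{\mu/2}}{2^{\nu+1}z^{\nu+\mu+1}\,\Gamma(\nu+\frac32)}\,{}_2F_1\Bigl(\frac{\nu+\mu}{2}+1,\frac{\nu+\mu+1}{2};\nu+\frac32;\frac1{z^2}\Bigr),$$ with ${}_2F_1$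 the Gauss hypergeometric function (analytically continued to $(-\infty,1)$), and $C_l^\mu(x)=\frac{(2\mu)_l}{l!}\,{}_2F_1\bigl(-l,l+2\mu;\mu+\frac12;\frac{1-x}{2}\bigr)$ is the Gegenbauer polynomial. -/

import Mathlib

noncomputable section

/-- The Minkowski bilinear form `[x, y] = x₀ y₀ - x₁ y₁ - ⋯ - x_d y_d` on `ℝ^{d+1}`. -/
def minkowskiForm {d : ℕ} (x y : Fin (d + 1) → ℝ) : ℝ :=
  x 0 * y 0 - ∑ i : Fin d, x i.succ * y i.succ

/-- The hyperboloid model `H_R^d`: the upper sheet of `[x, x] = R²`. -/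
def hyperboloid (d : ℕ) (R : ℝ) : Set (Fin (d + 1) → ℝ) :=
  {x | minkowskiForm x x = R ^ 2 ∧ 0 < x 0}

/-- The geodesic distance `ρ(x/R, x'/R) = arcosh [x/R, x'/R]` of the projections to the unit
hyperboloid. -/
def hypRho {d : ℕ} (R : ℝ) (x x' : Fin (d + 1) → ℝ) : ℝ :=
  Real.arcosh (minkowskiForm (fun i => x i / R) (fun i => x' i / R))

/-- `I_d(ρ) = ∫_ρ^∞ dt / sinh^{d-1} t`. -/
def fundIntegral (d : ℕ) (ρ : ℝ) : ℝ :=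
  ∫ t in Set.Ioi ρ, 1 / Real.sinh t ^ (d - 1)

/-- The spherically symmetric fundamental solution of `-Δ` on `H_R^d`. -/
def fundSol (d : ℕ) (R : ℝ) (x x' : Fin (d + 1) → ℝ) : ℝ :=
  Real.Gamma ((d : ℝ) / 2) / (2 * Real.pi ^ ((d : ℝ) / 2) * R ^ (d - 2)) *
    fundIntegral d (hypRho R x x')

/-- The point with geodesic polar coordinates `(r, ω)`, `ω` on the unit sphere of `ℝ^d`:
`x₀ = R cosh r` and `(x₁, …, x_d) = R sinh r · ω`. -/
def geodesicPolar {d : ℕ} (R r : ℝ) (ω : EuclideanSpace ℝ (Fin d)) : Fin (d + 1) → ℝ :=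
  Fin.cons (R * Real.cosh r) (fun i => R * Real.sinh r * ω i)

/-- The Gauss hypergeometric function `₂F₁(a, b; c; x)` for real parameters with `c ≠ 0, -1, …` and
real `x < 1`. For `0 ≤ x` it is the power series. For `x < 0` it is the analytic continuation of
that series along the negative axis, written through Pfaff's transformation
`₂F₁(a, b; c; x) = (1 - x)^{-a} ₂F₁(a, c - b; c; x / (x - 1))`, where `0 < x / (x - 1) < 1`. -/
def gaussF (a b c x : ℝ) : ℝ :=
  if 0 ≤ x then ₂F₁ a b c x
  else (1 - x) ^ (-a) * ₂F₁ a (c - b) c (x / (x - 1))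

/-- The associated Legendre function of the first kind `P_ν^μ` on `(1, ∞)`, for real `ν` and real
`μ ≠ 1, 2, …`. -/
def assocLegendreP (ν μ z : ℝ) : ℝ :=
  1 / Real.Gamma (1 - μ) * ((z + 1) / (z - 1)) ^ (μ / 2) *
    gaussF (-ν) (ν + 1) (1 - μ) ((1 - z) / 2)

/-- The associated Legendre function of the second kind `Q_ν^μ` on `(1, ∞)`, for real `ν`, `μ` with
`ν + μ ≠ -1, -2, …` and `ν + 3/2 ≠ 0, -1, …`, in the normalization with the factor `e^{iπμ}`. -/
def assocLegendreQ (ν μ z : ℝ) : ℂ :=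
  Complex.exp (Complex.I * Real.pi * μ) *
    ((Real.sqrt Real.pi * Real.Gamma (ν + μ + 1) * (z ^ 2 - 1) ^ (μ / 2) /
      ((2 : ℝ) ^ (ν + 1) * z ^ (ν + μ + 1) * Real.Gamma (ν + 3 / 2)) *
      gaussF ((ν + μ) / 2 + 1) ((ν + μ + 1) / 2) (ν + 3 / 2) (1 / z ^ 2) : ℝ) : ℂ)

/-- The Gegenbauer polynomial
`C_l^μ(x) = ((2μ)_l / l!) ₂F₁(-l, l + 2μ; μ + 1/2; (1 - x)/2)` (a finite sum). -/
def gegenbauerC (l : ℕ) (μ x : ℝ) : ℝ :=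
  (ascPochhammer ℝ l).eval (2 * μ) / (l.factorial : ℝ) *
    ₂F₁ (-(l : ℝ)) ((l : ℝ) + 2 * μ) (μ + 1 / 2) ((1 - x) / 2)

/-- The `l`-th term
`(-1)^l (2l+d-2) P_{d/2-1}^{-(d/2-1+l)}(cosh r_<) Q_{d/2-1}^{d/2-1+l}(cosh r_>) C_l^{d/2-1}(cos γ)`,
with `r_< = min r r'` and `r_> = max r r'`. -/
def gegenbauerTerm (d : ℕ) (r r' γ : ℝ) (l : ℕ) : ℂ :=
  (-1) ^ l * (2 * (l : ℂ) + (d : ℂ) - 2) *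
    (assocLegendreP ((d : ℝ) / 2 - 1) (-((d : ℝ) / 2 - 1 + l)) (Real.cosh (min r r')) : ℂ) *
    assocLegendreQ ((d : ℝ) / 2 - 1) ((d : ℝ) / 2 - 1 + l) (Real.cosh (max r r')) *
    (gegenbauerC l ((d : ℝ) / 2 - 1) (Real.cos γ) : ℂ)

end

section

open Finset

/-! Put l = d/2 - 1, let r < s be the two radii, and regard the kernel as a function of c = cos γ
through Z = cosh r cosh s - sinh r sinh s · c, the hyperbolic cosine of the distance. The integral
I_d(arcosh Z) has Z-derivative -(Z² - 1)^(-d/2), so its c-derivative is sinh r sinh s (Z² -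
1)^(-(l+1)). With a = tanh(r/2) and b = tanh(s/2), Z - 1 and Z + 1 are multiples of 1 - 2(a/b)c +
(a/b)² and 1 - 2abc + (ab)², so this derivative is a product of two Gegenbauer generating functions
of order l + 1.

Dougall's linearization formula `gegenbauerC_mul_gegenbauerC` turns that product into a single
series in C_n^(l+1)(c) (`hasSum_product_generating`). Its coefficients separate in r and s: the
factor C_n^(l+1)(coth s) is Q_l^(l+n+1)(cosh s) by `assocLegendreQ_succ`, and a^n times a Gauss
series in a² is P_l^(-(l+n+1))(cosh r) by `assocLegendreP_succ`, both up to elementary factors. This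
gives `hasSum_additionCoeff`.

Since the derivative of C_(n+1)^l is 2l C_n^(l+1), termwise integration yields every term of
positive degree and leaves a constant in c. Averaging against (1 - c²)^((d-3)/2) fixes the constant:
Gegenbauer polynomials of positive degree have mean zero, and the kernel has mean I_d(s), its value
at the centre, by the mean value property `integral_fundIntegral_mul_weight`. By
`assocLegendreQ_zero` this constant is exactly the term of degree zero. -/

/-! ### Pochhammer symbols and descending factorials -/

lemma ascPochhammer_eval_add (x : ℝ) (m n : ℕ) :
    (ascPochhammer ℝ (m + n)).eval x =
      (ascPochhammer ℝ m).eval x * (ascPochhammer ℝ n).eval (x + m) := by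
  rw [← ascPochhammer_mul, Polynomial.eval_mul, Polynomial.eval_comp]
  simp

lemma ascPochhammer_eval_succ_left (x : ℝ) (n : ℕ) :
    (ascPochhammer ℝ (n + 1)).eval x = x * (ascPochhammer ℝ n).eval (x + 1) := by
  rw [add_comm n 1, ascPochhammer_eval_add]
  simp

lemma ascPochhammer_eval_ne_zero {x : ℝ} (hx : 0 < x) (n : ℕ) :
    (ascPochhammer ℝ n).eval x ≠ 0 := (ascPochhammer_pos n x hx).ne'

lemma ascPochhammer_eval_neg_natCast (l j : ℕ) :
    (ascPochhammer ℝ j).eval (-(l : ℝ)) = (-1) ^ j * (l.descFactorial j : ℝ) := by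
  rw [ascPochhammer_eval_neg_eq_descPochhammer, descPochhammer_eval_eq_descFactorial]

lemma cast_descFactorial_succ (l j : ℕ) :
    ((l.descFactorial (j + 1) : ℕ) : ℝ) = ((l : ℝ) - j) * (l.descFactorial j : ℝ) := by
  rw [Nat.descFactorial_succ, Nat.cast_mul]
  rcases le_or_gt j l with h | h
  · rw [Nat.cast_sub h]
  · rw [Nat.descFactorial_of_lt h]; simp

lemma cast_succ_descFactorial (l j : ℕ) :
    ((l : ℝ) + 1 - j) * ((l + 1).descFactorial j : ℝ) = ((l : ℝ) + 1) * (l.descFactorial j : ℝ) := by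
  rw [← Nat.cast_succ l, ← cast_descFactorial_succ, Nat.succ_descFactorial_succ]
  push_cast; ring

/-! ### Gegenbauer polynomials: recurrence, derivative, Rodrigues relation -/

/-- The coefficient of `((1 - x) / 2) ^ j` in the Gegenbauer polynomial `C_n^μ`. -/
noncomputable def gegenbauerCoeff (μ : ℝ) (n j : ℕ) : ℝ :=
  (-1) ^ j * (ascPochhammer ℝ (n + j)).eval (2 * μ) * (n.descFactorial j : ℝ) /
    (n.factorial * j.factorial * (ascPochhammer ℝ j).eval (μ + 1 / 2))

/-- The Gegenbauer polynomial `C_n^μ`, as a polynomial in `(1 - x) / 2`. -/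
noncomputable def gegenbauerPoly (μ : ℝ) (n : ℕ) : Polynomial ℝ :=
  ∑ j ∈ range (n + 1), Polynomial.C (gegenbauerCoeff μ n j) * Polynomial.X ^ j

lemma gegenbauerPoly_coeff (μ : ℝ) (n j : ℕ) :
    (gegenbauerPoly μ n).coeff j = gegenbauerCoeff μ n j := by
  simp only [gegenbauerPoly, Polynomial.finsetSum_coeff, Polynomial.coeff_C_mul,
    Polynomial.coeff_X_pow, mul_ite, mul_one, mul_zero, sum_ite_eq, mem_range]
  split_ifs with h
  · rfl
  · rw [gegenbauerCoeff, Nat.descFactorial_of_lt (by omega)]; simp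

lemma gegenbauerC_eq_eval (n : ℕ) (μ x : ℝ) :
    gegenbauerC n μ x = (gegenbauerPoly μ n).eval ((1 - x) / 2) := by
  rw [gegenbauerC, ordinaryHypergeometric_eq_tsum, gegenbauerPoly, Polynomial.eval_finsetSum]
  beta_reduce
  rw [tsum_eq_sum (s := range (n + 1)), mul_sum]
  · refine sum_congr rfl fun j _ => ?_
    rw [ascPochhammer_eval_neg_natCast, add_comm (n : ℝ)]
    simp only [Polynomial.eval_mul, Polynomial.eval_C, Polynomial.eval_pow, Polynomial.eval_X,
      smul_eq_mul, gegenbauerCoeff, ascPochhammer_eval_add]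
    field_simp
  · intro j hj
    rw [ascPochhammer_eval_neg_natCast, Nat.descFactorial_of_lt (by simpa using hj)]
    simp

lemma gegenbauerC_zero (μ x : ℝ) : gegenbauerC 0 μ x = 1 := by
  rw [gegenbauerC_eq_eval]
  simp [gegenbauerPoly, gegenbauerCoeff]

lemma gegenbauerC_one {μ : ℝ} (hμ : 0 < μ) (x : ℝ) : gegenbauerC 1 μ x = 2 * μ * x := by
  rw [gegenbauerC_eq_eval]
  have : μ + 1 / 2 ≠ 0 := by positivity
  simp [gegenbauerPoly, gegenbauerCoeff, sum_range_succ, ascPochhammer_succ_eval]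
  field_simp
  ring

/-- The classical three-term recurrence, with x = 1 - 2X in the variable X = (1 - x)/2. It is
checked coefficient by coefficient, after every Pochhammer symbol and factorial has been reduced to
a common one. -/
lemma gegenbauerPoly_recurrence {μ : ℝ} (hμ : 0 < μ) (n : ℕ) :
    Polynomial.C ((n : ℝ) + 2) * gegenbauerPoly μ (n + 2) =
      Polynomial.C (2 * ((n : ℝ) + 1 + μ)) *
        (gegenbauerPoly μ (n + 1) - Polynomial.C 2 * (gegenbauerPoly μ (n + 1) * Polynomial.X)) -
      Polynomial.C ((n : ℝ) + 2 * μ) * gegenbauerPoly μ n := by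
  ext j
  rcases j with _ | j
  · simp only [Polynomial.coeff_C_mul, Polynomial.coeff_sub, gegenbauerPoly_coeff,
      Polynomial.coeff_mul_X_zero, gegenbauerCoeff, ascPochhammer_succ_eval, add_zero]
    simp [Nat.factorial_succ]
    field_simp
    ring
  · simp only [Polynomial.coeff_C_mul, Polynomial.coeff_sub, gegenbauerPoly_coeff,
      Polynomial.coeff_mul_X, gegenbauerCoeff]
    have h1 : (((n + 2).descFactorial (j + 1) : ℕ) : ℝ) = (n + 2) * ((n + 1).descFactorial j) := by
      rw [Nat.succ_descFactorial_succ]; push_cast; ring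
    have h2 : (((n + 1).descFactorial (j + 1) : ℕ) : ℝ) = (n + 1 - j) * ((n + 1).descFactorial j) := by
      rw [cast_descFactorial_succ]; push_cast; ring
    have h3 : ((n.descFactorial (j + 1) : ℕ) : ℝ) =
        (n - j) * ((n + 1 - j) * ((n + 1).descFactorial j) / (n + 1)) := by
      rw [cast_descFactorial_succ, cast_succ_descFactorial]; field_simp
    rw [h1, h2, h3, show n + 2 + (j + 1) = n + j + 1 + 1 + 1 by ring,
      show n + 1 + (j + 1) = n + j + 1 + 1 by ring, show n + 1 + j = n + j + 1 by ring,
      show n + (j + 1) = n + j + 1 by ring]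
    rw [ascPochhammer_succ_eval (n + j + 1 + 1), ascPochhammer_succ_eval (n + j + 1),
      ascPochhammer_succ_eval j (μ + 1 / 2)]
    have h4 := ascPochhammer_eval_ne_zero (x := μ + 1 / 2) (by positivity) j
    have h5 : μ + 1 / 2 + j ≠ 0 := by positivity
    have h6 : (n : ℝ) + 1 ≠ 0 := by positivity
    have h7 : (n : ℝ) + 2 ≠ 0 := by positivity
    have h8 : (n : ℝ) + 1 + 1 ≠ 0 := by positivity
    simp only [Nat.factorial_succ, Nat.cast_mul, Nat.cast_add, Nat.cast_one, pow_succ]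
    field_simp
    ring

lemma gegenbauerC_recurrence {μ : ℝ} (hμ : 0 < μ) (n : ℕ) (x : ℝ) :
    ((n : ℝ) + 2) * gegenbauerC (n + 2) μ x =
      2 * ((n : ℝ) + 1 + μ) * x * gegenbauerC (n + 1) μ x -
        ((n : ℝ) + 2 * μ) * gegenbauerC n μ x := by
  have h := congrArg (Polynomial.eval ((1 - x) / 2)) (gegenbauerPoly_recurrence hμ n)
  simp only [Polynomial.eval_mul, Polynomial.eval_sub, Polynomial.eval_C, Polynomial.eval_X,
    ← gegenbauerC_eq_eval] at h
  rw [h]; ring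

/-- A sequence with the initial values and the three-term recurrence of the Gegenbauer
polynomials is the sequence of Gegenbauer polynomials. -/
lemma eq_gegenbauerC_of_recurrence {𝕜 : Type*} [RCLike 𝕜] {μ : ℝ} (hμ : 0 < μ) (x : ℝ) (S : ℕ → 𝕜)
    (h0 : S 0 = 1) (h1 : S 1 = 2 * (μ : 𝕜) * x)
    (h : ∀ n : ℕ, ((n : 𝕜) + 2) * S (n + 2) =
      2 * ((n : 𝕜) + 1 + μ) * x * S (n + 1) - ((n : 𝕜) + 2 * μ) * S n) (n : ℕ) :
    S n = (gegenbauerC n μ x : 𝕜) := by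
  induction n using Nat.twoStepInduction with
  | zero => simp [h0, gegenbauerC_zero]
  | one => rw [h1, gegenbauerC_one hμ]; push_cast; ring
  | more n ih1 ih2 =>
    have h2 : ((n : 𝕜) + 2) ≠ 0 := by exact_mod_cast (by omega : n + 2 ≠ 0)
    apply mul_left_cancel₀ h2
    rw [h, ih1, ih2]
    have := congrArg (fun t : ℝ => (t : 𝕜)) (gegenbauerC_recurrence hμ n x)
    push_cast at this
    rw [this]

lemma gegenbauerPoly_derivative {μ : ℝ} (hμ : 0 < μ) (n : ℕ) :
    Polynomial.derivative (gegenbauerPoly μ (n + 1)) =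
      Polynomial.C (-(4 * μ)) * gegenbauerPoly (μ + 1) n := by
  ext j
  simp only [Polynomial.coeff_derivative, Polynomial.coeff_C_mul, gegenbauerPoly_coeff,
    gegenbauerCoeff]
  rw [Nat.succ_descFactorial_succ, show n + 1 + (j + 1) = n + j + 1 + 1 by ring,
    ascPochhammer_eval_succ_left (2 * μ), ascPochhammer_eval_succ_left (2 * μ + 1),
    ascPochhammer_eval_succ_left (μ + 1 / 2), show 2 * μ + 1 + 1 = 2 * (μ + 1) by ring,
    show μ + 1 / 2 + 1 = μ + 1 + 1 / 2 by ring]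
  have h4 := ascPochhammer_eval_ne_zero (x := μ + 1 + 1 / 2) (by positivity) j
  have h5 : μ + 1 / 2 ≠ 0 := by positivity
  have h6 : 2 * μ + 1 ≠ 0 := by positivity
  generalize (ascPochhammer ℝ j).eval (μ + 1 + 1 / 2) = u at *
  generalize (ascPochhammer ℝ (n + j)).eval (2 * (μ + 1)) = v at *
  simp only [Nat.factorial_succ, Nat.cast_mul, Nat.cast_add, Nat.cast_one, pow_succ]
  field_simp
  ring

/-- This is Gegenbauer's differential equation for C_(n+1)^μ in the variable X = (1 - x)/2, where 1
- x² = 4X(1 - X), with the first derivative already replaced by a multiple of C_n^(μ+1). On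
coefficients, it combines that replacement (`key`) with the two-term hypergeometric recurrence
(`rec0`). -/
lemma gegenbauerPoly_euler {μ : ℝ} (hμ : 0 < μ) (n : ℕ) :
    Polynomial.C (4 * μ) * (Polynomial.derivative (gegenbauerPoly (μ + 1) n) * Polynomial.X -
        Polynomial.derivative (gegenbauerPoly (μ + 1) n) * Polynomial.X * Polynomial.X) +
      Polynomial.C (2 * μ * (2 * μ + 1)) *
        (gegenbauerPoly (μ + 1) n - Polynomial.C 2 * (gegenbauerPoly (μ + 1) n * Polynomial.X)) =
      Polynomial.C (((n : ℝ) + 1) * (n + 1 + 2 * μ)) * gegenbauerPoly μ (n + 1) := by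
  have key : ∀ j : ℕ, ((j : ℝ) + 1) * gegenbauerCoeff μ (n + 1) (j + 1) =
      -(4 * μ) * gegenbauerCoeff (μ + 1) n j := fun j => by
    have := congrArg (fun p => Polynomial.coeff p j) (gegenbauerPoly_derivative hμ n)
    simp only [Polynomial.coeff_derivative, Polynomial.coeff_C_mul, gegenbauerPoly_coeff] at this
    linarith
  have rec0 : ∀ j : ℕ, ((j : ℝ) + 1) * (μ + 1 / 2 + j) * gegenbauerCoeff μ (n + 1) (j + 1) =
      -((n : ℝ) + 1 - j) * (2 * μ + n + 1 + j) * gegenbauerCoeff μ (n + 1) j := fun j => by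
    simp only [gegenbauerCoeff]
    rw [cast_descFactorial_succ, show n + 1 + (j + 1) = n + 1 + j + 1 by ring,
      ascPochhammer_succ_eval (n + 1 + j), ascPochhammer_succ_eval j]
    have h4 := ascPochhammer_eval_ne_zero (x := μ + 1 / 2) (by positivity) j
    have h5 : μ + 1 / 2 + j ≠ 0 := by positivity
    generalize (ascPochhammer ℝ j).eval (μ + 1 / 2) = u at *
    simp only [Nat.factorial_succ j, Nat.cast_mul, Nat.cast_add, Nat.cast_one, pow_succ]
    field_simp
    ring
  ext j
  rcases j with _ | j
  · simp only [Polynomial.coeff_C_mul, Polynomial.coeff_sub, Polynomial.coeff_add,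
      gegenbauerPoly_coeff, Polynomial.coeff_mul_X_zero]
    have h1 := key 0
    have h2 := rec0 0
    push_cast at h1 h2
    linear_combination (μ + 1 / 2) * h1 - h2
  · rcases j with _ | j
    · simp only [Polynomial.coeff_C_mul, Polynomial.coeff_sub, Polynomial.coeff_add,
        gegenbauerPoly_coeff, Polynomial.coeff_mul_X, Polynomial.coeff_mul_X_zero,
        Polynomial.coeff_derivative]
      have h1 := key 0
      have h2 := key 1
      have h3 := rec0 1
      push_cast at h1 h2 h3 ⊢
      simp only [zero_add] at h1 h2 h3 ⊢
      linear_combination (μ + 3 / 2) * h2 - h3 - (2 * μ + 1) * h1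
    · simp only [Polynomial.coeff_C_mul, Polynomial.coeff_sub, Polynomial.coeff_add,
        gegenbauerPoly_coeff, Polynomial.coeff_mul_X, Polynomial.coeff_derivative]
      have h1 := key (j + 1)
      have h2 := key (j + 2)
      have h3 := rec0 (j + 2)
      push_cast at h1 h2 h3 ⊢
      simp only [show j + 2 = j + 1 + 1 from rfl] at h1 h2 h3 ⊢
      linear_combination (μ + 1 / 2 + j + 2) * h2 - h3 - (2 * μ + 2 + j) * h1

lemma hasDerivAt_gegenbauerC {μ : ℝ} (hμ : 0 < μ) (n : ℕ) (x : ℝ) :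
    HasDerivAt (gegenbauerC (n + 1) μ) (2 * μ * gegenbauerC n (μ + 1) x) x := by
  have h1 : HasDerivAt (fun x : ℝ => (1 - x) / 2) (-1 / 2) x :=
    ((hasDerivAt_id x).const_sub 1).div_const 2
  have h2 := ((gegenbauerPoly μ (n + 1)).hasDerivAt ((1 - x) / 2)).comp x h1
  rw [gegenbauerPoly_derivative hμ] at h2
  rw [show gegenbauerC (n + 1) μ =
    (fun x => (gegenbauerPoly μ (n + 1)).eval x) ∘ fun x => (1 - x) / 2 from
      funext (gegenbauerC_eq_eval _ _), gegenbauerC_eq_eval]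
  refine h2.congr_deriv ?_
  simp only [Polynomial.eval_mul, Polynomial.eval_C]
  ring

lemma continuous_gegenbauerC (n : ℕ) (μ : ℝ) : Continuous (gegenbauerC n μ) := by
  rw [show gegenbauerC n μ =
    fun x => (gegenbauerPoly μ n).eval ((1 - x) / 2) from funext (gegenbauerC_eq_eval _ _)]
  fun_prop

/-- Rodrigues-type lowering relation: the derivative of `(1 - x²)^(μ + 1/2) C_n^(μ + 1)`. -/
lemma hasDerivAt_rpow_mul_gegenbauerC {μ : ℝ} (hμ : 0 < μ) (n : ℕ) {x : ℝ} (hx : x ∈ Set.Ioo (-1) 1) :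
    HasDerivAt (fun x => (1 - x ^ 2) ^ (μ + 1 / 2) * gegenbauerC n (μ + 1) x)
      (-(((n : ℝ) + 1) * (n + 1 + 2 * μ) / (2 * μ)) *
        (gegenbauerC (n + 1) μ x * (1 - x ^ 2) ^ (μ - 1 / 2))) x := by
  have hpos : 0 < 1 - x ^ 2 := by nlinarith [hx.1, hx.2]
  have h1 : HasDerivAt (fun x : ℝ => (1 - x) / 2) (-1 / 2) x :=
    ((hasDerivAt_id x).const_sub 1).div_const 2
  have h2 := ((gegenbauerPoly (μ + 1) n).hasDerivAt ((1 - x) / 2)).comp x h1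
  have h3 : HasDerivAt (fun x : ℝ => 1 - x ^ 2) (-(2 * x)) x := by
    simpa using (hasDerivAt_pow 2 x).const_sub 1
  have h4 := (h3.rpow_const (p := μ + 1 / 2) (Or.inl hpos.ne')).mul h2
  have h5 := congrArg (Polynomial.eval ((1 - x) / 2)) (gegenbauerPoly_euler hμ n)
  simp only [Polynomial.eval_mul, Polynomial.eval_sub, Polynomial.eval_add, Polynomial.eval_C,
    Polynomial.eval_X] at h5
  rw [show (fun x => (1 - x ^ 2) ^ (μ + 1 / 2) * gegenbauerC n (μ + 1) x) =
    (fun y => (1 - y ^ 2) ^ (μ + 1 / 2)) *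
      (fun x => (gegenbauerPoly (μ + 1) n).eval x) ∘ fun x => (1 - x) / 2 from
    funext fun y => by simp [gegenbauerC_eq_eval]]
  refine h4.congr_deriv ?_
  rw [gegenbauerC_eq_eval, show μ + 1 / 2 - 1 = μ - 1 / 2 by ring,
    show μ + 1 / 2 = μ - 1 / 2 + 1 by ring, Real.rpow_add_one hpos.ne']
  simp only [Function.comp]
  generalize (1 - x ^ 2) ^ (μ - 1 / 2) = v at *
  field_simp
  linear_combination (-v) * h5

/-! ### Binomial series and the Gegenbauer generating function -/

/-- The coefficient `(μ)_j / j!` of the binomial series of `(1 - x) ^ (-μ)`. -/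
noncomputable def negBinomCoeff (μ : ℝ) (j : ℕ) : ℝ :=
  (ascPochhammer ℝ j).eval μ / j.factorial

lemma negBinomCoeff_pos {μ : ℝ} (hμ : 0 < μ) (j : ℕ) : 0 < negBinomCoeff μ j :=
  div_pos (ascPochhammer_pos j μ hμ) (by positivity)

lemma negBinomCoeff_zero (μ : ℝ) : negBinomCoeff μ 0 = 1 := by simp [negBinomCoeff]

lemma negBinomCoeff_succ (μ : ℝ) (j : ℕ) :
    ((j : ℝ) + 1) * negBinomCoeff μ (j + 1) = (μ + j) * negBinomCoeff μ j := by
  simp only [negBinomCoeff, ascPochhammer_succ_eval, Nat.factorial_succ, Nat.cast_mul,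
    Nat.cast_add, Nat.cast_one]
  field_simp

lemma negBinomCoeff_eq_choose (μ : ℝ) (j : ℕ) :
    negBinomCoeff μ j = Ring.choose (μ + j - 1) j := by
  have h := Ring.factorial_nsmul_multichoose_eq_ascPochhammer μ j
  rw [Ring.choose, show μ + j - 1 - j + 1 = μ by ring, negBinomCoeff,
    div_eq_iff (by positivity), mul_comm]
  rw [nsmul_eq_mul] at h
  rw [h, Polynomial.ascPochhammer_smeval_eq_eval]

lemma hasSum_negBinomCoeff {μ x : ℝ} (hx : |x| < 1) :
    HasSum (fun j => negBinomCoeff μ j * x ^ j) ((1 - x) ^ (-μ)) := by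
  have h := (Real.one_div_one_sub_rpow_hasFPowerSeriesOnBall_zero μ).hasSum (y := x)
    (by simpa [enorm_eq_nnnorm] using! hx)
  rw [Real.rpow_neg (by linarith [(abs_lt.1 hx).2]), ← one_div]
  simpa [FormalMultilinearSeries.ofScalars_apply_eq, negBinomCoeff_eq_choose, mul_comm] using h

lemma hasSum_negBinomCoeff_complex {μ : ℝ} {z : ℂ} (hz : ‖z‖ < 1) :
    HasSum (fun j => (negBinomCoeff μ j : ℂ) * z ^ j) ((1 - z) ^ (-(μ : ℂ))) := by
  have h := (Complex.one_div_one_sub_cpow_hasFPowerSeriesOnBall_zero μ).hasSum (y := z)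
    (by simpa [enorm_eq_nnnorm] using! hz)
  rw [Complex.cpow_neg, ← one_div]
  have e : ∀ j : ℕ, (negBinomCoeff μ j : ℂ) = Ring.choose ((μ : ℂ) + j - 1) j := fun j => by
    rw [negBinomCoeff_eq_choose, Complex.ofReal_choose]; push_cast; rfl
  simpa [FormalMultilinearSeries.ofScalars_apply_eq, e, mul_comm] using h

section Laurent

variable {𝕜 : Type*} [RCLike 𝕜]

/-- `∑_{i + j = n} (μ)_i (μ)_j / (i! j!) w^i w'^j`. -/
noncomputable def gegenbauerSum (μ : ℝ) (w w' : 𝕜) (n : ℕ) : 𝕜 :=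
  ∑ p ∈ antidiagonal n, ((negBinomCoeff μ p.1 : 𝕜) * w ^ p.1) * ((negBinomCoeff μ p.2 : 𝕜) * w' ^ p.2)

lemma negBinomSeries_derivative (μ : ℝ) (w : 𝕜) :
    (1 - PowerSeries.C w * PowerSeries.X) *
        PowerSeries.derivative 𝕜 (PowerSeries.mk fun j => (negBinomCoeff μ j : 𝕜) * w ^ j) =
      PowerSeries.C ((μ : 𝕜) * w) * PowerSeries.mk fun j => (negBinomCoeff μ j : 𝕜) * w ^ j := by
  have key : ∀ j : ℕ, ((j : 𝕜) + 1) * (negBinomCoeff μ (j + 1) : 𝕜) =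
      ((μ : 𝕜) + j) * (negBinomCoeff μ j : 𝕜) := fun j => by
    exact_mod_cast congrArg (fun t : ℝ => (t : 𝕜)) (negBinomCoeff_succ μ j)
  ext j
  rw [sub_mul, one_mul, mul_assoc, map_sub, PowerSeries.coeff_C_mul, PowerSeries.coeff_C_mul]
  rcases j with _ | j
  · rw [PowerSeries.coeff_zero_X_mul, PowerSeries.coeff_derivative]
    simp only [PowerSeries.coeff_mk]
    have := key 0
    push_cast at this ⊢
    linear_combination w * this
  · rw [PowerSeries.coeff_succ_X_mul, PowerSeries.coeff_derivative, PowerSeries.coeff_derivative]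
    simp only [PowerSeries.coeff_mk]
    have := key (j + 1)
    push_cast at this ⊢
    linear_combination (w ^ (j + 2)) * this

/-- The sums are the coefficients of G = (1 - wX)^(-μ) (1 - w'X)^(-μ). Because w w' = 1, the
equations of the two factors combine into (1 - (w + w')X + X²) G' = μ(w + w' - 2X) G, and the
coefficient of X^(n+1) is the recurrence. -/
lemma gegenbauerSum_recurrence (μ : ℝ) {w w' : 𝕜} (hw : w * w' = 1) (n : ℕ) :
    ((n : 𝕜) + 2) * gegenbauerSum μ w w' (n + 2) =
      ((n : 𝕜) + 1 + μ) * (w + w') * gegenbauerSum μ w w' (n + 1) -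
        ((n : 𝕜) + 2 * μ) * gegenbauerSum μ w w' n := by
  set A : PowerSeries 𝕜 := PowerSeries.mk fun j => (negBinomCoeff μ j : 𝕜) * w ^ j with hA
  set B : PowerSeries 𝕜 := PowerSeries.mk fun j => (negBinomCoeff μ j : 𝕜) * w' ^ j with hB
  have hS : ∀ n, gegenbauerSum μ w w' n = PowerSeries.coeff n (A * B) := fun n => by
    rw [PowerSeries.coeff_mul]; simp [gegenbauerSum, hA, hB]
  have h1 := negBinomSeries_derivative μ w
  have h2 := negBinomSeries_derivative μ w'
  rw [← hA] at h1
  rw [← hB] at h2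
  have hww : (PowerSeries.C w * PowerSeries.C w' : PowerSeries 𝕜) = 1 := by
    rw [← map_mul, hw, map_one]
  have h3 : PowerSeries.derivative 𝕜 (A * B) -
        PowerSeries.C (w + w') * (PowerSeries.X * PowerSeries.derivative 𝕜 (A * B)) +
        PowerSeries.X * (PowerSeries.X * PowerSeries.derivative 𝕜 (A * B)) =
      PowerSeries.C ((μ : 𝕜) * (w + w')) * (A * B) -
        PowerSeries.C (2 * (μ : 𝕜)) * (PowerSeries.X * (A * B)) := by
    rw [Derivation.leibniz, smul_eq_mul, smul_eq_mul]
    simp only [map_mul, map_add, map_ofNat] at h1 h2 ⊢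
    set x : PowerSeries 𝕜 := PowerSeries.X
    set dA := PowerSeries.derivative 𝕜 A
    set dB := PowerSeries.derivative 𝕜 B
    set a : PowerSeries 𝕜 := PowerSeries.C w
    set b : PowerSeries 𝕜 := PowerSeries.C w'
    set m : PowerSeries 𝕜 := PowerSeries.C (μ : 𝕜)
    linear_combination (1 - b * x) * B * h1 + (1 - a * x) * A * h2 -
      (x ^ 2 * (A * dB + B * dA) + 2 * m * x * A * B) * hww
  have h4 := congrArg (PowerSeries.coeff (n + 1)) h3
  rw [map_add, map_sub, map_sub, PowerSeries.coeff_C_mul, PowerSeries.coeff_C_mul,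
    PowerSeries.coeff_C_mul, PowerSeries.coeff_succ_X_mul, PowerSeries.coeff_succ_X_mul,
    PowerSeries.coeff_succ_X_mul, PowerSeries.coeff_derivative, PowerSeries.coeff_derivative] at h4
  rcases n with _ | n
  · rw [PowerSeries.coeff_zero_X_mul] at h4
    rw [hS, hS, hS]
    push_cast at h4 ⊢
    linear_combination h4
  · rw [PowerSeries.coeff_succ_X_mul, PowerSeries.coeff_derivative] at h4
    rw [hS, hS, hS]
    push_cast at h4 ⊢
    linear_combination h4

/-- Both scalar fields are needed: w = e^(iθ) covers x = cos θ in [-1, 1], and real w = 1/b covers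
arguments above 1 such as coth s. -/
lemma gegenbauerSum_eq_gegenbauerC {μ : ℝ} (hμ : 0 < μ) {w w' : 𝕜} (hw : w * w' = 1) {x : ℝ}
    (hx : w + w' = 2 * (x : 𝕜)) (n : ℕ) : gegenbauerSum μ w w' n = (gegenbauerC n μ x : 𝕜) := by
  refine eq_gegenbauerC_of_recurrence hμ x _ ?_ ?_ (fun n => ?_) n
  · simp [gegenbauerSum, negBinomCoeff_zero]
  · have h1 : negBinomCoeff μ 1 = μ := by simp [negBinomCoeff]
    simp [gegenbauerSum, Nat.antidiagonal_succ, negBinomCoeff_zero, h1]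
    linear_combination (μ : 𝕜) * hx
  · rw [gegenbauerSum_recurrence μ hw, hx]; ring

end Laurent

/-- With x = cos θ, the polynomial is a combination of unit complex numbers with positive
coefficients, and at x = 1 all of these numbers equal 1. -/
lemma abs_gegenbauerC_le {μ : ℝ} (hμ : 0 < μ) (n : ℕ) {x : ℝ} (hx : x ∈ Set.Icc (-1) 1) :
    |gegenbauerC n μ x| ≤ gegenbauerC n μ 1 := by
  have h1 := gegenbauerSum_eq_gegenbauerC hμ (w := (1 : ℝ)) (w' := 1) (x := 1) (by norm_num)
    (by norm_num) n
  set w : ℂ := Complex.exp (Real.arccos x * Complex.I) with hw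
  set w' : ℂ := Complex.exp (-(Real.arccos x * Complex.I)) with hw'
  have hww : w * w' = 1 := by rw [hw, hw', ← Complex.exp_add]; simp
  have hadd : w + w' = 2 * ((x : ℝ) : ℂ) := by
    rw [hw, hw', ← neg_mul, ← Complex.two_cos, ← Complex.ofReal_cos,
      Real.cos_arccos hx.1 hx.2]
  have h2 := gegenbauerSum_eq_gegenbauerC hμ hww hadd n
  have n1 : ‖w‖ = 1 := by rw [hw, Complex.norm_exp_ofReal_mul_I]
  have n2 : ‖w'‖ = 1 := by
    rw [hw', ← neg_mul, ← Complex.ofReal_neg, Complex.norm_exp_ofReal_mul_I]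
  have h3 : |gegenbauerC n μ x| = ‖gegenbauerSum μ w w' n‖ := by
    rw [h2]; exact (Complex.norm_real _).symm
  rw [h3]
  simp only [RCLike.ofReal_real_eq_id, id] at h1
  rw [← h1]
  refine (norm_sum_le _ _).trans (sum_le_sum fun p _ => ?_)
  simp only [norm_mul, norm_pow, n1, n2, one_pow, mul_one, RCLike.norm_ofReal,
    abs_of_pos (negBinomCoeff_pos hμ _), RCLike.ofReal_real_eq_id, id, le_refl]

/-- The generating function of the Gegenbauer polynomials. -/
lemma hasSum_gegenbauerC_mul_pow {μ : ℝ} (hμ : 0 < μ) {x h : ℝ} (hx : x ∈ Set.Icc (-1) 1)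
    (hh : |h| < 1) :
    HasSum (fun n => gegenbauerC n μ x * h ^ n) ((1 - 2 * h * x + h ^ 2) ^ (-μ)) := by
  set w : ℂ := Complex.exp (Real.arccos x * Complex.I) with hw
  set w' : ℂ := Complex.exp (-(Real.arccos x * Complex.I)) with hw'
  have hww : w * w' = 1 := by rw [hw, hw', ← Complex.exp_add]; simp
  have hadd : w + w' = 2 * ((x : ℝ) : ℂ) := by
    rw [hw, hw', ← neg_mul, ← Complex.two_cos, ← Complex.ofReal_cos,
      Real.cos_arccos hx.1 hx.2]
  have n1 : ‖w‖ = 1 := by rw [hw, Complex.norm_exp_ofReal_mul_I]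
  have n2 : ‖w'‖ = 1 := by
    rw [hw', ← neg_mul, ← Complex.ofReal_neg, Complex.norm_exp_ofReal_mul_I]
  have hsum : ∀ z : ℂ, ‖z‖ < 1 → Summable fun j => ‖(negBinomCoeff μ j : ℂ) * z ^ j‖ := by
    intro z hz
    refine (hasSum_negBinomCoeff (μ := μ) (x := ‖z‖) (by simpa using hz)).summable.congr
      fun j => ?_
    rw [norm_mul, norm_pow, Complex.norm_real, Real.norm_of_nonneg (negBinomCoeff_pos hμ j).le]
  have hz1 : ‖w * h‖ < 1 := by rw [norm_mul, n1, one_mul, Complex.norm_real]; exact hh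
  have hz2 : ‖w' * h‖ < 1 := by rw [norm_mul, n2, one_mul, Complex.norm_real]; exact hh
  have hp := summable_norm_sum_mul_antidiagonal_of_summable_norm (hsum _ hz1) (hsum _ hz2)
  have ht := tsum_mul_tsum_eq_tsum_sum_antidiagonal_of_summable_norm (hsum _ hz1) (hsum _ hz2)
  rw [(hasSum_negBinomCoeff_complex hz1).tsum_eq, (hasSum_negBinomCoeff_complex hz2).tsum_eq] at ht
  have hS := hp.of_norm.hasSum
  rw [← ht] at hS
  -- The two binomial factors are complex conjugates in the right half-plane, where the principal
  -- power commutes with conjugation. Their product is therefore a real power of |1 - wh|².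
  have hconj : 1 - w' * h = (starRingEnd ℂ) (1 - w * h) := by
    rw [map_sub, map_mul, map_one, Complex.conj_ofReal, hw, hw', ← Complex.exp_conj, map_mul,
      Complex.conj_ofReal, Complex.conj_I, mul_neg]
  have hnorm : ‖1 - w * h‖ ^ 2 = 1 - 2 * h * x + h ^ 2 := by
    have : ((‖1 - w * h‖ ^ 2 : ℝ) : ℂ) = ((1 - 2 * h * x + h ^ 2 : ℝ) : ℂ) := by
      push_cast
      rw [← Complex.mul_conj', ← hconj]
      linear_combination (-(h : ℂ)) * hadd + (h : ℂ) ^ 2 * hww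
    exact_mod_cast this
  have hre : 0 < (1 - w * h).re := by
    have := (Complex.abs_re_le_norm (w * h)).trans_lt hz1
    rw [Complex.sub_re, Complex.one_re]
    linarith [(abs_lt.1 this).2]
  have hval : (1 - w * h) ^ (-(μ : ℂ)) * (1 - w' * h) ^ (-(μ : ℂ)) =
      (((1 - 2 * h * x + h ^ 2) ^ (-μ) : ℝ) : ℂ) := by
    rw [hconj, Complex.conj_cpow _ _ (Complex.mem_slitPlane_iff_arg.1 (Or.inl hre)).1, ← hnorm, map_neg,
      Complex.conj_ofReal, Complex.mul_conj', ← Complex.ofReal_neg, Complex.norm_cpow_real,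
      ← Complex.ofReal_pow, ← Real.rpow_natCast, ← Real.rpow_natCast, ← Real.rpow_mul (norm_nonneg _),
      ← Real.rpow_mul (norm_nonneg _), mul_comm (-μ)]
  rw [hval] at hS
  rw [← Complex.hasSum_ofReal]
  refine hS.congr_fun fun n => ?_
  have h2 : ∑ p ∈ antidiagonal n, ((negBinomCoeff μ p.1 : ℂ) * w ^ p.1) *
      ((negBinomCoeff μ p.2 : ℂ) * w' ^ p.2) = (gegenbauerC n μ x : ℂ) :=
    gegenbauerSum_eq_gegenbauerC hμ hww hadd n
  rw [Complex.ofReal_mul, ← h2, sum_mul]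
  refine sum_congr rfl fun p hp => ?_
  rw [← mem_antidiagonal.1 hp, mul_pow, mul_pow, Complex.ofReal_pow, pow_add]
  ring

/-! ### Dougall's linearization formula -/

lemma negBinomCoeff_succ_eq (μ : ℝ) (j : ℕ) :
    negBinomCoeff μ (j + 1) = (μ + j) / (j + 1) * negBinomCoeff μ j := by
  rw [div_mul_eq_mul_div, ← negBinomCoeff_succ, mul_div_cancel_left₀ _ (by positivity)]

/-- The factor of the linearization coefficients that depends on `s = i + j` and `k` only. -/
noncomputable def linearizationRatio (μ : ℝ) (s k : ℕ) : ℝ :=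
  (s + μ) / (s + k + μ) * ((ascPochhammer ℝ (s + k)).eval (2 * μ) /
    (ascPochhammer ℝ (s + k)).eval μ) * (s.factorial / (ascPochhammer ℝ s).eval (2 * μ))

/-- The coefficient of `C_{i + j}^μ` in the linearization of `C_{k + i}^μ C_{k + j}^μ`. -/
noncomputable def linearizationCoeff (μ : ℝ) (k i j : ℕ) : ℝ :=
  negBinomCoeff μ k * negBinomCoeff μ i * negBinomCoeff μ j * linearizationRatio μ (i + j) k

lemma linearizationRatio_pos {μ : ℝ} (hμ : 0 < μ) (s k : ℕ) : 0 < linearizationRatio μ s k := by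
  have h1 := ascPochhammer_pos (s + k) (2 * μ) (by positivity)
  have h2 := ascPochhammer_pos (s + k) μ hμ
  have h3 := ascPochhammer_pos s (2 * μ) (by positivity)
  unfold linearizationRatio
  positivity

lemma linearizationCoeff_pos {μ : ℝ} (hμ : 0 < μ) (k i j : ℕ) : 0 < linearizationCoeff μ k i j :=
  mul_pos (mul_pos (mul_pos (negBinomCoeff_pos hμ _) (negBinomCoeff_pos hμ _))
    (negBinomCoeff_pos hμ _)) (linearizationRatio_pos hμ _ _)

lemma linearizationCoeff_symm (μ : ℝ) (k i j : ℕ) :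
    linearizationCoeff μ k i j = linearizationCoeff μ k j i := by
  rw [linearizationCoeff, linearizationCoeff, add_comm i j]; ring

lemma linearizationCoeff_zero {μ : ℝ} (hμ : 0 < μ) (i : ℕ) : linearizationCoeff μ 0 i 0 = 1 := by
  have h1 := ascPochhammer_eval_ne_zero hμ i
  have h2 := ascPochhammer_eval_ne_zero (x := 2 * μ) (by positivity) i
  have h3 : (i : ℝ) + μ ≠ 0 := by positivity
  simp only [linearizationCoeff, linearizationRatio, negBinomCoeff, add_zero]
  generalize (ascPochhammer ℝ i).eval (2 * μ) = u at *
  simp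
  field_simp

/-- The rational identity left over from `linearizationCoeff_rec` once all Pochhammer symbols,
factorials and binomial coefficients are divided out. -/
lemma linearizationCoeff_rec_aux {μ P K J : ℝ} (hμ : 0 < μ) (hP : 0 ≤ P) (hK : 0 ≤ K)
    (hJ : 0 ≤ J) :
    (K + J + 2) * ((μ + K) * (μ + J) * (P + 2 * J + 2 + μ) * (2 * μ + (P + 2 * J + K + 2)) /
        ((K + 1) * (J + 1) * (P + 2 * J + K + 3 + μ) * (2 * μ + (P + 2 * J + 1)))) =
      (K + J + 1 + μ) * ((μ + K) / (K + 1) +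
        (μ + P + J + 1) * (μ + J) * (2 * μ + (P + 2 * J + K + 2)) *
          (P + 2 * J + 3) / ((P + J + 2) * (J + 1) * (P + 2 * J + K + 3 + μ) *
            (2 * μ + (P + 2 * J + 1)))) -
      (K + J + 2 * μ) * ((μ + P + J + 1) * (P + 2 * J + 2 + μ) /
        ((P + J + 2) * (2 * μ + (P + 2 * J + 1)))) := by
  field_simp
  ring

lemma linearizationCoeff_rec {μ : ℝ} (hμ : 0 < μ) (p k j : ℕ) :
    ((k : ℝ) + j + 2) * linearizationCoeff μ (k + 1) (p + j + 1) (j + 1) =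
      (k + j + 1 + μ) * (linearizationCoeff μ (k + 1) (p + j + 1) j * (p + 2 * j + 2) /
          (p + 2 * j + 1 + μ) +
        linearizationCoeff μ k (p + j + 2) (j + 1) * (p + 2 * j + 2 + 2 * μ) /
          (p + 2 * j + 3 + μ)) -
      (k + j + 2 * μ) * linearizationCoeff μ k (p + j + 2) j := by
  simp only [linearizationCoeff, linearizationRatio, negBinomCoeff_succ_eq]
  rw [show p + j + 1 + (j + 1) + (k + 1) = p + 2 * j + k + 2 + 1 by ring,
    show p + j + 1 + j + (k + 1) = p + 2 * j + k + 2 by ring,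
    show p + j + 2 + (j + 1) + k = p + 2 * j + k + 2 + 1 by ring,
    show p + j + 2 + j + k = p + 2 * j + k + 2 by ring,
    show p + j + 1 + (j + 1) = p + 2 * j + 1 + 1 by ring,
    show p + j + 1 + j = p + 2 * j + 1 by ring,
    show p + j + 2 + (j + 1) = p + 2 * j + 1 + 1 + 1 by ring,
    show p + j + 2 + j = p + 2 * j + 1 + 1 by ring]
  simp only [ascPochhammer_succ_eval (p + 2 * j + k + 2), ascPochhammer_succ_eval (p + 2 * j + 1 + 1),
    ascPochhammer_succ_eval (p + 2 * j + 1), Nat.factorial_succ (p + 2 * j + 1 + 1),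
    Nat.factorial_succ (p + 2 * j + 1), Nat.cast_mul]
  have h1 := ascPochhammer_eval_ne_zero hμ (p + 2 * j + k + 2)
  have h2 := ascPochhammer_eval_ne_zero (x := 2 * μ) (by positivity) (p + 2 * j + 1)
  generalize (ascPochhammer ℝ (p + 2 * j + k + 2)).eval μ = A at *
  generalize (ascPochhammer ℝ (p + 2 * j + k + 2)).eval (2 * μ) = A' at *
  generalize (ascPochhammer ℝ (p + 2 * j + 1)).eval (2 * μ) = A'' at *
  push_cast
  have hp : (0 : ℝ) ≤ p := p.cast_nonneg
  have hk : (0 : ℝ) ≤ k := k.cast_nonneg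
  have hj : (0 : ℝ) ≤ j := j.cast_nonneg
  generalize (((p + 2 * j + 1).factorial : ℕ) : ℝ) = F at *
  generalize (negBinomCoeff μ j) = F1 at *
  generalize (negBinomCoeff μ k) = F2 at *
  generalize (negBinomCoeff μ (p + j)) = F3 at *
  generalize (p : ℝ) = P at *
  generalize (k : ℝ) = K at *
  generalize (j : ℝ) = J at *
  -- `X` is the common factor of all four linearization coefficients; dividing by it leaves
  -- `linearizationCoeff_rec_aux`.
  obtain ⟨X, hX⟩ : ∃ X, X = F1 * F2 * F3 * ((μ + (P + J)) / (P + J + 1)) * A' / A * F / A'' *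
    (P + 2 * J + 2) / (P + 2 * J + K + 2 + μ) := ⟨_, rfl⟩
  have h := congrArg (fun t => X * t) (linearizationCoeff_rec_aux hμ hp hk hj)
  have h3 : 2 * μ + (P + 2 * J + 1) ≠ 0 := by positivity
  have h4 : μ + (P + 2 * J + K + 2) ≠ 0 := by positivity
  beta_reduce at h
  rw [mul_left_comm, mul_sub, mul_left_comm X (K + J + 1 + μ), mul_add X,
    mul_left_comm X (K + J + 2 * μ)] at h
  refine Eq.trans (congrArg _ ?_) (h.trans (congrArg₂ _ (congrArg _ (congrArg₂ _ ?_ ?_))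
    (congrArg _ ?_)))
  all_goals
    rw [hX]
    field_simp
    try ring

lemma linearizationCoeff_rec_zero_left {μ : ℝ} (hμ : 0 < μ) (p j : ℕ) :
    ((j : ℝ) + 1) * linearizationCoeff μ 0 (p + j + 1) (j + 1) =
      (j + μ) * (linearizationCoeff μ 0 (p + j + 1) j * (p + 2 * j + 2) / (p + 2 * j + 1 + μ)) := by
  simp only [linearizationCoeff, linearizationRatio, negBinomCoeff_succ_eq, add_zero]
  rw [show p + j + 1 + (j + 1) = p + 2 * j + 1 + 1 by ring,
    show p + j + 1 + j = p + 2 * j + 1 by ring]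
  simp only [ascPochhammer_succ_eval (p + 2 * j + 1), Nat.factorial_succ (p + 2 * j + 1),
    Nat.cast_mul]
  have h1 := ascPochhammer_eval_ne_zero hμ (p + 2 * j + 1)
  have h2 := ascPochhammer_eval_ne_zero (x := 2 * μ) (by positivity) (p + 2 * j + 1)
  generalize (ascPochhammer ℝ (p + 2 * j + 1)).eval μ = A at *
  generalize (ascPochhammer ℝ (p + 2 * j + 1)).eval (2 * μ) = A'' at *
  push_cast
  have hp : (0 : ℝ) ≤ p := p.cast_nonneg
  have hj : (0 : ℝ) ≤ j := j.cast_nonneg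
  generalize (((p + 2 * j + 1).factorial : ℕ) : ℝ) = F at *
  generalize (negBinomCoeff μ j) = F1 at *
  generalize (negBinomCoeff μ 0) = F2 at *
  generalize (negBinomCoeff μ (p + j)) = F3 at *
  generalize (p : ℝ) = P at *
  generalize (j : ℝ) = J at *
  have h3 : 2 * μ + (P + 2 * J + 1) ≠ 0 := by positivity
  have h4 : μ + (P + 2 * J + 1) ≠ 0 := by positivity
  field_simp
  ring

lemma linearizationCoeff_rec_zero_right {μ : ℝ} (hμ : 0 < μ) (p k : ℕ) :
    ((k : ℝ) + 1) * linearizationCoeff μ (k + 1) p 0 =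
      (k + μ) * (linearizationCoeff μ k (p + 1) 0 * (p + 2 * μ) / (p + 1 + μ)) := by
  simp only [linearizationCoeff, linearizationRatio, negBinomCoeff_succ_eq, add_zero]
  rw [show p + (k + 1) = p + k + 1 by ring, show p + 1 + k = p + k + 1 by ring]
  simp only [ascPochhammer_succ_eval p, Nat.factorial_succ p, Nat.cast_mul]
  have h1 := ascPochhammer_eval_ne_zero hμ (p + k + 1)
  have h2 := ascPochhammer_eval_ne_zero (x := 2 * μ) (by positivity) p
  generalize (ascPochhammer ℝ (p + k + 1)).eval μ = A at *
  generalize (ascPochhammer ℝ (p + k + 1)).eval (2 * μ) = A' at *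
  generalize (ascPochhammer ℝ p).eval (2 * μ) = A'' at *
  push_cast
  have hp : (0 : ℝ) ≤ p := p.cast_nonneg
  have hk : (0 : ℝ) ≤ k := k.cast_nonneg
  generalize ((p.factorial : ℕ) : ℝ) = F at *
  generalize (negBinomCoeff μ k) = F1 at *
  generalize (negBinomCoeff μ 0) = F2 at *
  generalize (negBinomCoeff μ p) = F3 at *
  generalize (p : ℝ) = P at *
  generalize (k : ℝ) = K at *
  field_simp
  ring

lemma mul_gegenbauerC_succ {μ : ℝ} (hμ : 0 < μ) (s : ℕ) (x : ℝ) :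
    2 * (x * gegenbauerC (s + 1) μ x) = ((s + 2) / (s + 1 + μ)) * gegenbauerC (s + 2) μ x +
      ((s + 2 * μ) / (s + 1 + μ)) * gegenbauerC s μ x := by
  have h := gegenbauerC_recurrence hμ s x
  field_simp
  linarith

/-- Shift a function on an antidiagonal up in the second variable. -/
def shiftSnd (f : ℕ × ℕ → ℝ) : ℕ × ℕ → ℝ
  | (_, 0) => 0
  | (k, j + 1) => f (k, j)

/-- Shift a function on an antidiagonal up in the first variable. -/
def shiftFst (f : ℕ × ℕ → ℝ) : ℕ × ℕ → ℝ
  | (0, _) => 0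
  | (k + 1, j) => f (k, j)

lemma sum_shiftSnd (f : ℕ × ℕ → ℝ) (n : ℕ) :
    ∑ p ∈ antidiagonal (n + 1), shiftSnd f p = ∑ p ∈ antidiagonal n, f p := by
  rw [Nat.sum_antidiagonal_succ']; simp [shiftSnd]

lemma sum_shiftFst (f : ℕ × ℕ → ℝ) (n : ℕ) :
    ∑ p ∈ antidiagonal (n + 1), shiftFst f p = ∑ p ∈ antidiagonal n, f p := by
  rw [Nat.sum_antidiagonal_succ]; simp [shiftFst]

/-- Dougall's linearization formula for products of Gegenbauer polynomials. -/
lemma gegenbauerC_mul_gegenbauerC {μ : ℝ} (hμ : 0 < μ) (x : ℝ) (n p : ℕ) :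
    gegenbauerC (n + p) μ x * gegenbauerC n μ x =
      ∑ q ∈ antidiagonal n, linearizationCoeff μ q.1 (p + q.2) q.2 *
        gegenbauerC (p + 2 * q.2) μ x := by
  induction n using Nat.twoStepInduction generalizing p with
  | zero => simp [linearizationCoeff_zero hμ, gegenbauerC_zero]
  | one =>
    have h1 := linearizationCoeff_rec_zero_left hμ p 0
    have h2 := linearizationCoeff_rec_zero_right hμ p 0
    simp only [Nat.cast_zero, zero_add, one_mul, mul_zero, add_zero,
      linearizationCoeff_zero hμ] at h1 h2
    have h3 := mul_gegenbauerC_succ hμ p x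
    rw [Nat.sum_antidiagonal_succ]
    simp only [Nat.antidiagonal_zero, sum_singleton, zero_add, mul_zero, add_zero, mul_one, h1, h2,
      gegenbauerC_one hμ]
    rw [add_comm 1 p]
    linear_combination μ * h3
  | more n ih1 ih2 =>
    have e1 := ih2 (p + 1)
    have e2 := ih1 (p + 2)
    have hrec := gegenbauerC_recurrence hμ n x
    rw [show n + 1 + (p + 1) = n + 2 + p by ring] at e1
    rw [show n + (p + 2) = n + 2 + p by ring] at e2
    -- Multiplication by 2x moves a Gegenbauer polynomial one degree up (`T1`) and one degree down
    -- (`T2`); `T3` comes from the lower term of the recurrence. On the antidiagonal of n + 2 these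
    -- are shifted in the second index, in the first, and in both.
    set T1 : ℕ × ℕ → ℝ := fun q => (n + 1 + μ) * (linearizationCoeff μ q.1 (p + 1 + q.2) q.2 *
      ((p + 2 * q.2 + 2) / (p + 2 * q.2 + 1 + μ)) * gegenbauerC (p + 2 * q.2 + 2) μ x) with hT1
    set T2 : ℕ × ℕ → ℝ := fun q => (n + 1 + μ) * (linearizationCoeff μ q.1 (p + 1 + q.2) q.2 *
      ((p + 2 * q.2 + 2 * μ) / (p + 2 * q.2 + 1 + μ)) * gegenbauerC (p + 2 * q.2) μ x) with hT2
    set T3 : ℕ × ℕ → ℝ := fun q => (n + 2 * μ) * (linearizationCoeff μ q.1 (p + 2 + q.2) q.2 *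
      gegenbauerC (p + 2 + 2 * q.2) μ x) with hT3
    have h12 : 2 * (n + 1 + μ) * x * (gegenbauerC (n + 2 + p) μ x * gegenbauerC (n + 1) μ x) =
        ∑ q ∈ antidiagonal (n + 1), T1 q + ∑ q ∈ antidiagonal (n + 1), T2 q := by
      rw [e1, mul_sum, ← sum_add_distrib]
      refine sum_congr rfl fun q _ => ?_
      have h3 := mul_gegenbauerC_succ hμ (p + 2 * q.2) x
      rw [show p + 2 * q.2 + 1 = p + 1 + 2 * q.2 by ring] at h3
      push_cast at h3
      simp only [hT1, hT2]
      linear_combination (n + 1 + μ) * linearizationCoeff μ q.1 (p + 1 + q.2) q.2 * h3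
    have h3 : (n + 2 * μ) * (gegenbauerC (n + 2 + p) μ x * gegenbauerC n μ x) =
        ∑ q ∈ antidiagonal n, T3 q := by
      rw [e2, mul_sum]
    rw [← sum_shiftSnd T1, ← sum_shiftFst T2] at h12
    rw [← sum_shiftSnd T3, ← sum_shiftFst] at h3
    have hn : (n : ℝ) + 2 ≠ 0 := by positivity
    apply mul_left_cancel₀ hn
    have : ((n : ℝ) + 2) * (gegenbauerC (n + 2 + p) μ x * gegenbauerC (n + 2) μ x) =
        ∑ q ∈ antidiagonal (n + 1 + 1), (shiftSnd T1 q + shiftFst T2 q -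
          shiftFst (shiftSnd T3) q) := by
      rw [sum_sub_distrib, sum_add_distrib, ← h12, ← h3]
      linear_combination gegenbauerC (n + 2 + p) μ x * hrec
    rw [this, mul_sum]
    refine sum_congr rfl fun q hq => ?_
    obtain ⟨k, j⟩ := q
    have hq' : k + j = n + 1 + 1 := mem_antidiagonal.1 hq
    rcases k with _ | k
    · rcases j with _ | j
      · omega
      · obtain rfl : j = n + 1 := by omega
        have h := linearizationCoeff_rec_zero_left hμ p (n + 1)
        simp only [shiftFst, shiftSnd, hT1]
        rw [show p + 1 + (n + 1) = p + (n + 1) + 1 by ring, show p + (n + 1 + 1) = p + (n + 1) + 1 by ring,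
          show p + 2 * (n + 1 + 1) = p + 2 * (n + 1) + 2 by ring]
        push_cast at h ⊢
        linear_combination (-gegenbauerC (p + 2 * (n + 1) + 2) μ x) * h
    · rcases j with _ | j
      · obtain rfl : k = n + 1 := by omega
        have h := linearizationCoeff_rec_zero_right hμ p (n + 1)
        simp only [shiftFst, shiftSnd, hT2, mul_zero, add_zero]
        push_cast at h ⊢
        simp only [mul_zero, add_zero]
        linear_combination (-gegenbauerC p μ x) * h
      · obtain rfl : n = k + j := by omega
        have h := linearizationCoeff_rec hμ p k j
        simp only [shiftFst, shiftSnd, hT1, hT2, hT3]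
        rw [show p + 1 + (j + 1) = p + j + 2 by ring, show p + (j + 1) = p + j + 1 by ring,
          show p + 1 + j = p + j + 1 by ring, show p + 2 + j = p + j + 2 by ring,
          show p + 2 * (j + 1) = p + 2 * j + 2 by ring, show p + 2 + 2 * j = p + 2 * j + 2 by ring]
        push_cast at h ⊢
        rw [show (p : ℝ) + 2 * (j + 1) + 2 * μ = p + 2 * j + 2 + 2 * μ by ring,
          show (p : ℝ) + 2 * (j + 1) + 1 + μ = p + 2 * j + 3 + μ by ring]
        linear_combination (-gegenbauerC (p + 2 * j + 2) μ x) * h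

lemma gegenbauerC_mul_gegenbauerC_range {μ : ℝ} (hμ : 0 < μ) (x : ℝ) (m n : ℕ) :
    ∑ k ∈ range (min m n + 1), linearizationCoeff μ k (m - k) (n - k) *
        gegenbauerC ((m - k) + (n - k)) μ x = gegenbauerC m μ x * gegenbauerC n μ x := by
  have key : ∀ m n : ℕ, n ≤ m → ∑ k ∈ range (n + 1), linearizationCoeff μ k (m - k) (n - k) *
        gegenbauerC ((m - k) + (n - k)) μ x = gegenbauerC m μ x * gegenbauerC n μ x := by
    intro m n h
    obtain ⟨p, rfl⟩ := Nat.exists_eq_add_of_le h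
    rw [gegenbauerC_mul_gegenbauerC hμ, Nat.sum_antidiagonal_eq_sum_range_succ_mk]
    refine sum_congr rfl fun k hk => ?_
    have hk' : k ≤ n := by simpa [Nat.lt_succ_iff] using hk
    simp only
    rw [show n + p - k = p + (n - k) by omega, show p + (n - k) + (n - k) = p + 2 * (n - k) by ring]
  rcases le_total n m with h | h
  · rw [min_eq_right h, key m n h]
  · rw [min_eq_left h, mul_comm, ← key n m h]
    refine sum_congr rfl fun k _ => ?_
    rw [linearizationCoeff_symm, add_comm]

/-! ### Product of two generating functions -/

lemma gegenbauerC_one_nonneg {μ : ℝ} (hμ : 0 < μ) (n : ℕ) : 0 ≤ gegenbauerC n μ 1 :=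
  (abs_nonneg _).trans (abs_gegenbauerC_le hμ n (by norm_num : (1 : ℝ) ∈ Set.Icc (-1) 1))

lemma summable_gegenbauerC_mul_pow_norm {μ : ℝ} (hμ : 0 < μ) {x h : ℝ} (hx : x ∈ Set.Icc (-1) 1)
    (hh : |h| < 1) : Summable fun n => ‖gegenbauerC n μ x * h ^ n‖ := by
  have h1 := (hasSum_gegenbauerC_mul_pow hμ (x := 1) (h := |h|) (by norm_num)
    (by rwa [abs_abs])).summable
  refine Summable.of_nonneg_of_le (fun _ => norm_nonneg _) (fun n => ?_) h1
  rw [norm_mul, norm_pow, Real.norm_eq_abs, Real.norm_eq_abs]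
  gcongr
  exact abs_gegenbauerC_le hμ n hx

/-- The terms of the product of two generating functions, after linearization. -/
noncomputable def linearizedTerm (μ x u v : ℝ) (q : (ℕ × ℕ) × ℕ) : ℝ :=
  if q.2 ≤ q.1.1 ∧ q.2 ≤ q.1.2 then
    linearizationCoeff μ q.2 (q.1.1 - q.2) (q.1.2 - q.2) *
      gegenbauerC ((q.1.1 - q.2) + (q.1.2 - q.2)) μ x * (u ^ q.1.1 * v ^ q.1.2)
  else 0

lemma hasSum_linearizedTerm_fst {μ : ℝ} (hμ : 0 < μ) (x u v : ℝ) (q : ℕ × ℕ) :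
    HasSum (fun k => linearizedTerm μ x u v (q, k))
      ((gegenbauerC q.1 μ x * u ^ q.1) * (gegenbauerC q.2 μ x * v ^ q.2)) := by
  have h : (gegenbauerC q.1 μ x * u ^ q.1) * (gegenbauerC q.2 μ x * v ^ q.2) =
      ∑ k ∈ range (min q.1 q.2 + 1), linearizedTerm μ x u v (q, k) := by
    rw [mul_mul_mul_comm, ← gegenbauerC_mul_gegenbauerC_range hμ, sum_mul]
    refine sum_congr rfl fun k hk => ?_
    rw [mem_range, Nat.lt_succ_iff, le_min_iff] at hk
    rw [linearizedTerm, if_pos hk]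
  rw [h]
  refine hasSum_sum_of_ne_finset_zero fun k hk => ?_
  rw [mem_range, Nat.lt_succ_iff, le_min_iff] at hk
  rw [linearizedTerm, if_neg hk]

/-- The linearization coefficients are positive and |C_n(x)| ≤ C_n(1), so the triple series is
dominated by its value at x = 1. There all terms are nonnegative, and summing over k first reduces
summability to that of the product of the generating series. -/
lemma hasSum_linearizedTerm {μ : ℝ} (hμ : 0 < μ) {x u v : ℝ} (hx : x ∈ Set.Icc (-1) 1)
    (hu : 0 < u) (hu1 : u < 1) (hv : 0 < v) (hv1 : v < 1) :
    HasSum (linearizedTerm μ x u v)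
      ((1 - 2 * u * x + u ^ 2) ^ (-μ) * (1 - 2 * v * x + v ^ 2) ^ (-μ)) := by
  have hu' : |u| < 1 := by rwa [abs_of_pos hu]
  have hv' : |v| < 1 := by rwa [abs_of_pos hv]
  have h1m : (1 : ℝ) ∈ Set.Icc (-1) 1 := by norm_num
  have hprod : ∀ x ∈ Set.Icc (-1 : ℝ) 1, Summable fun q : ℕ × ℕ =>
      (gegenbauerC q.1 μ x * u ^ q.1) * (gegenbauerC q.2 μ x * v ^ q.2) := fun x hx =>
    summable_mul_of_summable_norm (summable_gegenbauerC_mul_pow_norm hμ hx hu')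
      (summable_gegenbauerC_mul_pow_norm hμ hx hv')
  have hnonneg : 0 ≤ linearizedTerm μ 1 u v := fun q => by
    have := gegenbauerC_one_nonneg hμ ((q.1.1 - q.2) + (q.1.2 - q.2))
    have := linearizationCoeff_pos hμ q.2 (q.1.1 - q.2) (q.1.2 - q.2)
    simp only [linearizedTerm, Pi.zero_apply]
    split_ifs <;> positivity
  have hs1 : Summable (linearizedTerm μ 1 u v) := by
    rw [summable_prod_of_nonneg hnonneg]
    refine ⟨fun q => (hasSum_linearizedTerm_fst hμ 1 u v q).summable, ?_⟩
    simp_rw [(hasSum_linearizedTerm_fst hμ 1 u v _).tsum_eq]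
    exact hprod 1 h1m
  have hs : Summable (linearizedTerm μ x u v) := by
    refine Summable.of_norm_bounded hs1 fun q => ?_
    have h1 := abs_gegenbauerC_le hμ ((q.1.1 - q.2) + (q.1.2 - q.2)) hx
    have h2 := linearizationCoeff_pos hμ q.2 (q.1.1 - q.2) (q.1.2 - q.2)
    simp only [linearizedTerm]
    split_ifs
    · rw [norm_mul, norm_mul, Real.norm_of_nonneg h2.le,
        Real.norm_of_nonneg (by positivity : 0 ≤ u ^ q.1.1 * v ^ q.1.2), Real.norm_eq_abs]
      gcongr
    · simp
  have h3 := hs.hasSum.prod_fiberwise (hasSum_linearizedTerm_fst hμ x u v)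
  have h4 := (hasSum_gegenbauerC_mul_pow hμ hx hu').mul (hasSum_gegenbauerC_mul_pow hμ hx hv')
    (hprod x hx)
  rw [h4.unique h3]
  exact hs.hasSum

/-- The product of two generating functions, expanded in Gegenbauer polynomials. -/
lemma hasSum_product_generating {μ : ℝ} (hμ : 0 < μ) {x y a b : ℝ} (hx : x ∈ Set.Icc (-1) 1)
    (ha : 0 < a) (hab : a < b) (hb : b < 1) (hy : b + b⁻¹ = 2 * y) :
    HasSum (fun n => gegenbauerC n μ x * (gegenbauerC n μ y * (a ^ n *
        ∑' k, negBinomCoeff μ k * linearizationRatio μ n k * (a ^ 2) ^ k)))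
      ((1 - 2 * (a / b) * x + (a / b) ^ 2) ^ (-μ) * (1 - 2 * (a * b) * x + (a * b) ^ 2) ^ (-μ)) := by
  have hb0 : 0 < b := ha.trans hab
  have h0 := hasSum_linearizedTerm hμ hx (u := a / b) (v := a * b) (by positivity)
    ((div_lt_one hb0).2 hab) (by positivity) (by nlinarith)
  -- Reindexing the degrees (m, n) as (k + i, k + j) parametrizes exactly the region k ≤ min(m, n),
  -- outside which the terms vanish.
  set e : (ℕ × ℕ) × ℕ → (ℕ × ℕ) × ℕ := fun q => ((q.2 + q.1.1, q.2 + q.1.2), q.2) with he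
  have hinj : Function.Injective e := by
    rintro ⟨⟨i, j⟩, k⟩ ⟨⟨i', j'⟩, k'⟩ h
    simp only [he, Prod.mk.injEq] at h ⊢
    omega
  rw [← hinj.hasSum_iff] at h0
  swap
  · rintro ⟨⟨m, n⟩, k⟩ hq
    rw [linearizedTerm, if_neg]
    rintro ⟨h1, h2⟩
    exact hq ⟨((m - k, n - k), k), Prod.ext (Prod.ext (Nat.add_sub_of_le h1) (Nat.add_sub_of_le h2)) rfl⟩
  have hterm : ∀ q : ℕ × ℕ, ∀ k, (linearizedTerm μ x (a / b) (a * b) ∘ e) (q, k) =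
      (negBinomCoeff μ q.1 * negBinomCoeff μ q.2 * gegenbauerC (q.1 + q.2) μ x *
        ((a / b) ^ q.1 * (a * b) ^ q.2)) *
        (negBinomCoeff μ k * linearizationRatio μ (q.1 + q.2) k * (a ^ 2) ^ k) := by
    rintro ⟨i, j⟩ k
    have huv : (a ^ 2) ^ k = (a / b) ^ k * (a * b) ^ k := by
      rw [← mul_pow]; congr 1; field_simp
    simp only [Function.comp, he, linearizedTerm, le_add_iff_nonneg_right, zero_le, and_self,
      if_true, Nat.add_sub_cancel_left, linearizationCoeff, huv, pow_add]
    ring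
  have h1 : HasSum (fun q : ℕ × ℕ => (negBinomCoeff μ q.1 * negBinomCoeff μ q.2 *
      gegenbauerC (q.1 + q.2) μ x * ((a / b) ^ q.1 * (a * b) ^ q.2)) *
        ∑' k, negBinomCoeff μ k * linearizationRatio μ (q.1 + q.2) k * (a ^ 2) ^ k)
      ((1 - 2 * (a / b) * x + (a / b) ^ 2) ^ (-μ) *
        (1 - 2 * (a * b) * x + (a * b) ^ 2) ^ (-μ)) := by
    refine h0.prod_fiberwise fun q => ?_
    have h2 := (h0.summable.prod_factor q).hasSum
    simp_rw [hterm q, tsum_mul_left] at h2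
    simpa only [hterm q] using h2
  replace h1 := (HasAntidiagonal.sigmaAntidiagonalEquivProd (A := ℕ)).hasSum_iff.2 h1
  refine (h1.sigma (fun n => hasSum_fintype _)).congr_fun fun n => ?_
  -- On i + j = n one has (a/b)^i (ab)^j = a^n b^(-i) b^j, and the rest of the summand depends on i
  -- and j only through the two binomial coefficients. The inner sum is therefore C_n(y), with w =
  -- 1/b and w' = b.
  have h3 := gegenbauerSum_eq_gegenbauerC (𝕜 := ℝ) hμ (inv_mul_cancel₀ hb0.ne')
    ((add_comm _ _).trans hy) n
  simp only [RCLike.ofReal_real_eq_id, id] at h3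
  rw [← h3, gegenbauerSum, sum_mul, mul_sum]
  symm
  rw [← sum_coe_sort (antidiagonal n)]
  refine sum_congr rfl fun p _ => ?_
  obtain ⟨⟨i, j⟩, hp⟩ := p
  obtain rfl := mem_antidiagonal.1 hp
  simp only [Function.comp, HasAntidiagonal.sigmaAntidiagonalEquivProd_apply, RCLike.ofReal_real_eq_id, id]
  rw [div_eq_mul_inv, mul_pow, mul_pow, pow_add]
  ring

/-! ### Gauss series and Euler's transformation -/

/-- The coefficients of the Gauss hypergeometric series, in the form used in Mathlib. -/
noncomputable def gaussCoeff (a b c : ℝ) (n : ℕ) : ℝ := ordinaryHypergeometricCoefficient a b c n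

lemma gaussCoeff_rec {c : ℝ} (hc : 0 < c) (a b : ℝ) (n : ℕ) :
    ((n : ℝ) + 1) * (n + c) * gaussCoeff a b c (n + 1) = (n + a) * (n + b) * gaussCoeff a b c n := by
  have h1 := ascPochhammer_eval_ne_zero hc n
  have h2 : c + n ≠ 0 := by positivity
  simp only [gaussCoeff, ordinaryHypergeometricCoefficient, ascPochhammer_succ_eval,
    Nat.factorial_succ, Nat.cast_mul, Nat.cast_add, Nat.cast_one]
  field_simp
  ring

/-- The radius of convergence is 1 unless a or b is a nonpositive integer, in which case the series
terminates; c > 0 excludes vanishing denominators. -/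
lemma summable_gaussCoeff {a b c x : ℝ} (hc : 0 < c) (hx : |x| < 1) :
    Summable fun n => gaussCoeff a b c n * x ^ n := by
  have hr : 1 ≤ (ordinaryHypergeometricSeries ℝ a b c).radius := by
    by_cases h : ∀ k : ℕ, (k : ℝ) ≠ -a ∧ (k : ℝ) ≠ -b ∧ (k : ℝ) ≠ -c
    · rw [ordinaryHypergeometricSeries_radius_eq_one _ _ _ _ h]
    · push Not at h
      obtain ⟨k, hk⟩ := h
      by_cases h1 : (k : ℝ) = -a
      · rw [show a = -(k : ℝ) by linarith, ordinaryHypergeometric_radius_top_of_neg_nat₁]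
        exact le_top
      by_cases h2 : (k : ℝ) = -b
      · rw [show b = -(k : ℝ) by linarith, ordinaryHypergeometric_radius_top_of_neg_nat₂]
        exact le_top
      · have := hk h1 h2
        have : (0 : ℝ) ≤ k := k.cast_nonneg
        linarith
  have h1 := (ordinaryHypergeometricSeries ℝ a b c).summable_norm_apply (x := x)
    (Metric.eball_subset_eball hr (by simpa [enorm_eq_nnnorm] using! hx))
  refine h1.of_norm.congr fun n => ?_
  rw [ordinaryHypergeometricSeries_apply_eq, smul_eq_mul, gaussCoeff]

lemma hasSum_gaussCoeff {a b c x : ℝ} (hc : 0 < c) (hx : |x| < 1) :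
    HasSum (fun n => gaussCoeff a b c n * x ^ n) (₂F₁ a b c x) := by
  have h := (summable_gaussCoeff (a := a) (b := b) hc hx).hasSum
  rw [ordinaryHypergeometric_eq_tsum]
  exact h

lemma coeff_X_mul_derivative (f : PowerSeries ℝ) (n : ℕ) :
    PowerSeries.coeff n (PowerSeries.X * PowerSeries.derivative ℝ f) =
      n * PowerSeries.coeff n f := by
  rcases n with _ | n
  · simp
  · rw [PowerSeries.coeff_succ_X_mul, PowerSeries.coeff_derivative]; push_cast; ring

lemma coeff_X_mul_X_mul_derivative (f : PowerSeries ℝ) (n : ℕ) :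
    PowerSeries.coeff n (PowerSeries.X * (PowerSeries.X *
      PowerSeries.derivative ℝ (PowerSeries.derivative ℝ f))) =
      n * (n - 1) * PowerSeries.coeff n f := by
  rcases n with _ | n
  · simp
  · rw [PowerSeries.coeff_succ_X_mul, coeff_X_mul_derivative, PowerSeries.coeff_derivative]
    push_cast; ring

/-- The left side of the hypergeometric differential equation, as a formal power series. -/
noncomputable def gaussOperator (a b c : ℝ) (f : PowerSeries ℝ) : PowerSeries ℝ :=
  PowerSeries.X * PowerSeries.derivative ℝ (PowerSeries.derivative ℝ f) -
    PowerSeries.X * (PowerSeries.X * PowerSeries.derivative ℝ (PowerSeries.derivative ℝ f)) +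
    PowerSeries.C c * PowerSeries.derivative ℝ f -
    PowerSeries.C (a + b + 1) * (PowerSeries.X * PowerSeries.derivative ℝ f) -
    PowerSeries.C (a * b) * f

lemma coeff_gaussOperator (a b c : ℝ) (f : PowerSeries ℝ) (n : ℕ) :
    PowerSeries.coeff n (gaussOperator a b c f) =
      (n + 1) * (n + c) * PowerSeries.coeff (n + 1) f -
        (n + a) * (n + b) * PowerSeries.coeff n f := by
  simp only [gaussOperator, map_sub, map_add (PowerSeries.coeff n), PowerSeries.coeff_C_mul,
    coeff_X_mul_X_mul_derivative, coeff_X_mul_derivative, PowerSeries.coeff_derivative]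
  ring

lemma eq_gaussCoeff_of_gaussOperator_eq_zero {a b c : ℝ} (hc : 0 < c) {f : PowerSeries ℝ}
    (h0 : PowerSeries.coeff 0 f = 1) (hf : gaussOperator a b c f = 0) (n : ℕ) :
    PowerSeries.coeff n f = gaussCoeff a b c n := by
  induction n with
  | zero => rw [h0]; simp [gaussCoeff, ordinaryHypergeometricCoefficient]
  | succ n ih =>
    have h1 := coeff_gaussOperator a b c f n
    rw [hf, map_zero, ih, ← gaussCoeff_rec hc] at h1
    have h2 : ((n : ℝ) + 1) * (n + c) ≠ 0 := by positivity
    exact mul_left_cancel₀ h2 (by linarith)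

lemma gaussOperator_mk_gaussCoeff {c : ℝ} (hc : 0 < c) (a b : ℝ) :
    gaussOperator a b c (PowerSeries.mk (gaussCoeff a b c)) = 0 := by
  ext n
  rw [coeff_gaussOperator, PowerSeries.coeff_mk, PowerSeries.coeff_mk, gaussCoeff_rec hc, sub_self,
    map_zero]

/-- Multiplication by (1 - X)^(c-a-b) carries formal solutions for the parameters (c - a, c - b, c)
to solutions for (a, b, c). Uniqueness of the solution with constant term 1 then gives Euler's
transformation. -/
lemma gaussOperator_euler {c : ℝ} (a b : ℝ) {k : PowerSeries ℝ}
    (hk : gaussOperator (c - a) (c - b) c k = 0) :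
    gaussOperator a b c (PowerSeries.mk (negBinomCoeff (-(c - a - b))) * k) = 0 := by
  have hB := negBinomSeries_derivative (-(c - a - b)) (1 : ℝ)
  simp only [map_one, one_mul, mul_one, one_pow, RCLike.ofReal_real_eq_id, id] at hB
  set B : PowerSeries ℝ := PowerSeries.mk (negBinomCoeff (-(c - a - b)))
  have hB' := congrArg (PowerSeries.derivative ℝ) hB
  rw [Derivation.leibniz, Derivation.leibniz, map_sub, Derivation.map_one_eq_zero,
    PowerSeries.derivative_C, PowerSeries.derivative_X] at hB'
  simp only [smul_eq_mul] at hB'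
  -- The equations for the derivatives of `B` carry a factor 1 - X, so the claim is proved after
  -- multiplying by 1 - X, which is cancellable in a domain.
  have hne : (1 - PowerSeries.X : PowerSeries ℝ) ≠ 0 := by
    intro h
    have := congrArg (PowerSeries.coeff 0) h
    simp at this
  refine (mul_eq_zero.1 ?_).resolve_left hne
  simp only [gaussOperator, Derivation.leibniz, smul_eq_mul, map_add] at hk ⊢
  set dB := PowerSeries.derivative ℝ B
  set ddB := PowerSeries.derivative ℝ dB
  set dk := PowerSeries.derivative ℝ k
  set ddk := PowerSeries.derivative ℝ dk
  simp only [map_sub, map_mul, map_neg, map_one] at hk hB hB' ⊢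
  set x : PowerSeries ℝ := PowerSeries.X
  set A : PowerSeries ℝ := PowerSeries.C a
  set A' : PowerSeries ℝ := PowerSeries.C b
  set D : PowerSeries ℝ := PowerSeries.C c
  linear_combination x * (1 - x) * k * hB' +
    (x * k * (1 - (D - A - A')) + 2 * x * (1 - x) * dk + (D - (A + A' + 1) * x) * k) * hB +
    (1 - x) * B * hk

/-- Euler's transformation of the Gauss hypergeometric function. -/
lemma ordinaryHypergeometric_euler {a b c x : ℝ} (hc : 0 < c) (hx : |x| < 1) :
    ₂F₁ a b c x = (1 - x) ^ (c - a - b) * ₂F₁ (c - a) (c - b) c x := by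
  have hB := hasSum_negBinomCoeff (μ := -(c - a - b)) hx
  have hk := hasSum_gaussCoeff (a := c - a) (b := c - b) hc hx
  rw [neg_neg] at hB
  rw [← hB.tsum_eq, ← hk.tsum_eq,
    tsum_mul_tsum_eq_tsum_sum_antidiagonal_of_summable_norm hB.summable.norm hk.summable.norm,
    ← (hasSum_gaussCoeff hc hx).tsum_eq]
  refine tsum_congr fun n => ?_
  rw [← eq_gaussCoeff_of_gaussOperator_eq_zero hc ?_
    (gaussOperator_euler a b (gaussOperator_mk_gaussCoeff hc (c - a) (c - b))) n,
    PowerSeries.coeff_mul, sum_mul]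
  · refine sum_congr rfl fun p hp => ?_
    rw [← mem_antidiagonal.1 hp, pow_add, PowerSeries.coeff_mk, PowerSeries.coeff_mk]
    ring
  · simp [negBinomCoeff_zero, gaussCoeff, ordinaryHypergeometricCoefficient]

/-! ### Closed forms of the Legendre functions -/

lemma ascPochhammer_eval_two_mul (x : ℝ) (j : ℕ) :
    (ascPochhammer ℝ (2 * j)).eval (2 * x) =
      4 ^ j * (ascPochhammer ℝ j).eval x * (ascPochhammer ℝ j).eval (x + 1 / 2) := by
  induction j with
  | zero => simp
  | succ j ih =>
    rw [show 2 * (j + 1) = 2 * j + 1 + 1 by ring]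
    simp only [ascPochhammer_succ_eval, ih]
    push_cast
    ring

/-- For z = cosh r and a = tanh(r/2), (z + 1)/(z - 1) = a^(-2), and the Pfaff branch of `gaussF` has
argument a². Euler's transformation then brings the parameters to those of the product expansion
with μ = l + 1. -/
lemma assocLegendreP_succ {l a z : ℝ} (hl : 0 < l) (n : ℕ) (ha : 0 < a) (ha1 : a < 1)
    (hz : z = (1 + a ^ 2) / (1 - a ^ 2)) :
    assocLegendreP l (-(l + ((n + 1 : ℕ) : ℝ))) z =
      a ^ (l + 1) * a ^ n * (1 - a ^ 2) ^ (l + 1) / Real.Gamma (l + 1 + n + 1) *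
        ₂F₁ (l + 1) (2 * (l + 1) + n) (l + 1 + n + 1) (a ^ 2) := by
  have h1 : 0 < 1 - a ^ 2 := by nlinarith
  have h2 : (z + 1) / (z - 1) = (a ^ (-2 : ℝ)) := by
    rw [Real.rpow_neg ha.le, Real.rpow_ofNat, hz]; field_simp; ring
  have h3 : ¬ (0 ≤ (1 - z) / 2) := by
    rw [not_le, hz]
    have : (1 - (1 + a ^ 2) / (1 - a ^ 2)) / 2 = -(a ^ 2 / (1 - a ^ 2)) := by field_simp; ring
    rw [this]
    exact neg_lt_zero.2 (by positivity)
  have h4 : 1 - (1 - z) / 2 = (1 - a ^ 2)⁻¹ := by rw [hz]; field_simp; ring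
  have h5 : (1 - z) / 2 / ((1 - z) / 2 - 1) = a ^ 2 := by
    rw [show (1 - z) / 2 - 1 = -(1 - a ^ 2)⁻¹ by linarith, hz]; field_simp; ring
  rw [assocLegendreP, gaussF, if_neg h3, h2, h4, h5,
    ordinaryHypergeometric_euler (c := 1 - -(l + ((n + 1 : ℕ) : ℝ)))
      (by rw [sub_neg_eq_add]; positivity) (by rw [abs_of_pos (by positivity)]; nlinarith),
    ← Real.rpow_mul ha.le, neg_neg, Real.inv_rpow h1.le, ← Real.rpow_neg h1.le]
  have e1 : -2 * (-(l + ((n + 1 : ℕ) : ℝ)) / 2) = l + 1 + (n : ℝ) := by push_cast; ring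
  have e2 : (1 - -(l + ((n + 1 : ℕ) : ℝ))) = l + 1 + n + 1 := by push_cast; ring
  have e3 : (1 - a ^ 2) ^ (l + 1) = (1 - a ^ 2) ^ (-l) * (1 - a ^ 2) ^ (2 * l + 1) := by
    rw [← Real.rpow_add h1]; congr 1; ring
  rw [e1, e2, show l + 1 + (n : ℝ) + 1 - -l = 2 * (l + 1) + n by ring,
    show l + 1 + (n : ℝ) + 1 - (l + 1 + n + 1 - (l + 1)) = l + 1 by ring,
    show 2 * (l + 1) + (n : ℝ) - (l + 1 + n + 1 - (l + 1)) = 2 * l + 1 by ring,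
    Real.rpow_add ha, Real.rpow_natCast, e3,
    ordinaryHypergeometric, ordinaryHypergeometric, ordinaryHypergeometricSeries_symm]
  ring

lemma assocLegendreP_zero {l a z : ℝ} (ha : 0 < a) (ha1 : a < 1)
    (hz : z = (1 + a ^ 2) / (1 - a ^ 2)) :
    assocLegendreP l (-l) z = (a / (1 - a ^ 2)) ^ l / Real.Gamma (l + 1) := by
  have h1 : 0 < 1 - a ^ 2 := by nlinarith
  have h2 : (z + 1) / (z - 1) = (a ^ (-2 : ℝ)) := by
    rw [Real.rpow_neg ha.le, Real.rpow_ofNat, hz]; field_simp; ring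
  have h3 : ¬ (0 ≤ (1 - z) / 2) := by
    rw [not_le, hz]
    have : (1 - (1 + a ^ 2) / (1 - a ^ 2)) / 2 = -(a ^ 2 / (1 - a ^ 2)) := by field_simp; ring
    rw [this]
    exact neg_lt_zero.2 (by positivity)
  have h4 : 1 - (1 - z) / 2 = (1 - a ^ 2)⁻¹ := by rw [hz]; field_simp; ring
  -- For order -l the second parameter after Pfaff's transformation is 0, so only the constant term
  -- survives.
  have h6 : ∀ x : ℝ, ₂F₁ (-l) (1 - -l - (l + 1)) (1 - -l) x = 1 := fun x => by
    rw [show 1 - -l - (l + 1) = 0 by ring, ordinaryHypergeometric_eq_tsum]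
    beta_reduce
    rw [tsum_eq_single 0]
    · simp
    · rintro (_ | n) hn
      · exact absurd rfl hn
      · simp [ascPochhammer_eval_succ_left]
  rw [assocLegendreP, gaussF, if_neg h3, h6, h2, h4, ← Real.rpow_mul ha.le, neg_neg,
    show -2 * (-l / 2) = l by ring, Real.div_rpow ha.le h1.le, Real.inv_rpow h1.le,
    show 1 - -l = l + 1 by ring]
  ring

/-- The coefficients of the series in the definition of `Q_ν^μ`, in terms of `(2μ)_{n + 2j}`. -/
noncomputable def legendreQCoeff (μ : ℝ) (n j : ℕ) : ℝ :=
  (ascPochhammer ℝ (n + 2 * j)).eval (2 * μ) /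
    (n.factorial * 4 ^ j * j.factorial * (ascPochhammer ℝ j).eval (μ + 1 / 2))

lemma legendreQCoeff_eq (μ : ℝ) (n j : ℕ) :
    legendreQCoeff μ n j = (ascPochhammer ℝ n).eval (2 * μ) / n.factorial *
      gaussCoeff (μ + n / 2 + 1 / 2) (μ + n / 2) (μ + 1 / 2) j := by
  rw [legendreQCoeff, ascPochhammer_eval_add, show 2 * μ + (n : ℝ) = 2 * (μ + n / 2) by ring,
    ascPochhammer_eval_two_mul]
  simp only [gaussCoeff, ordinaryHypergeometricCoefficient]
  field_simp

lemma legendreQCoeff_zero {μ : ℝ} (hμ : 0 < μ) (j : ℕ) :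
    legendreQCoeff μ 0 j = negBinomCoeff μ j := by
  have h := ascPochhammer_eval_ne_zero (x := μ + 1 / 2) (by positivity) j
  rw [legendreQCoeff, zero_add, ascPochhammer_eval_two_mul, negBinomCoeff]
  generalize (ascPochhammer ℝ j).eval (μ + 1 / 2) = u at *
  simp
  field_simp

lemma legendreQCoeff_one {μ : ℝ} (hμ : 0 < μ) (j : ℕ) :
    legendreQCoeff μ 1 j = 2 * μ * negBinomCoeff (μ + 1) j := by
  have h := ascPochhammer_eval_ne_zero (x := μ + 1 / 2) (by positivity) j
  rw [legendreQCoeff, add_comm 1, ascPochhammer_eval_succ_left,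
    show 2 * μ + 1 = 2 * (μ + 1 / 2) by ring, ascPochhammer_eval_two_mul, negBinomCoeff,
    show μ + 1 / 2 + 1 / 2 = μ + 1 by ring]
  generalize (ascPochhammer ℝ j).eval (μ + 1 / 2) = u at *
  simp
  field_simp

lemma legendreQCoeff_rec_zero {μ : ℝ} (n : ℕ) :
    ((n : ℝ) + 2) * legendreQCoeff μ (n + 2) 0 =
      2 * (n + 1 + μ) * legendreQCoeff μ (n + 1) 0 - (n + 2 * μ) * legendreQCoeff μ n 0 := by
  simp only [legendreQCoeff, mul_zero, add_zero, ascPochhammer_succ_eval, Nat.factorial_succ,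
    Nat.cast_mul]
  simp
  field_simp
  ring

lemma legendreQCoeff_rec_succ {μ : ℝ} (hμ : 0 < μ) (n j : ℕ) :
    ((n : ℝ) + 2) * (legendreQCoeff μ (n + 2) (j + 1) - legendreQCoeff μ (n + 2) j) =
      2 * (n + 1 + μ) * legendreQCoeff μ (n + 1) (j + 1) -
        (n + 2 * μ) * legendreQCoeff μ n (j + 1) := by
  have h := ascPochhammer_eval_ne_zero (x := μ + 1 / 2) (by positivity) j
  have h' : μ + 1 / 2 + j ≠ 0 := by positivity
  simp only [legendreQCoeff, show n + 2 + 2 * (j + 1) = n + 2 * j + 2 + 1 + 1 by ring,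
    show n + 2 + 2 * j = n + 2 * j + 2 by ring, show n + 1 + 2 * (j + 1) = n + 2 * j + 2 + 1 by ring,
    show n + 2 * (j + 1) = n + 2 * j + 2 by ring]
  simp only [ascPochhammer_succ_eval (n + 2 * j + 2), ascPochhammer_succ_eval (n + 2 * j + 2 + 1),
    ascPochhammer_succ_eval j, Nat.factorial_succ, Nat.cast_mul, pow_succ]
  generalize (ascPochhammer ℝ j).eval (μ + 1 / 2) = u at *
  generalize (ascPochhammer ℝ (n + 2 * j + 2)).eval (2 * μ) = v at *
  push_cast
  field_simp
  ring

lemma summable_legendreQCoeff {μ : ℝ} (hμ : 0 < μ) (n : ℕ) {s : ℝ} (hs : |s| < 1) :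
    Summable fun j => legendreQCoeff μ n j * s ^ j := by
  simp_rw [legendreQCoeff_eq, mul_assoc]
  exact (summable_gaussCoeff (by positivity) hs).mul_left _

/-- This is the Gegenbauer recurrence at y = 1/T after the factor T^(2μ+n) is removed: with s = 1 -
T², the factor 1 - s accounts for the two extra powers of T at index n + 2. -/
lemma tsum_legendreQCoeff_rec {μ : ℝ} (hμ : 0 < μ) (n : ℕ) {s : ℝ} (hs : |s| < 1) :
    ((n : ℝ) + 2) * ((1 - s) * ∑' j, legendreQCoeff μ (n + 2) j * s ^ j) =
      2 * (n + 1 + μ) * ∑' j, legendreQCoeff μ (n + 1) j * s ^ j -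
        (n + 2 * μ) * ∑' j, legendreQCoeff μ n j * s ^ j := by
  have S := fun n => summable_legendreQCoeff hμ n hs
  have S' := fun n => (summable_nat_add_iff 1).2 (S n)
  have e1 := (S (n + 2)).tsum_eq_zero_add
  have e2 := (S (n + 1)).tsum_eq_zero_add
  have e3 := (S n).tsum_eq_zero_add
  have key : ((n : ℝ) + 2) * (∑' j, legendreQCoeff μ (n + 2) (j + 1) * s ^ (j + 1) -
        s * ∑' j, legendreQCoeff μ (n + 2) j * s ^ j) =
      2 * (n + 1 + μ) * ∑' j, legendreQCoeff μ (n + 1) (j + 1) * s ^ (j + 1) -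
        (n + 2 * μ) * ∑' j, legendreQCoeff μ n (j + 1) * s ^ (j + 1) := by
    rw [← tsum_mul_left, ← (S' (n + 2)).tsum_sub ((S (n + 2)).mul_left s), ← tsum_mul_left,
      ← tsum_mul_left, ← tsum_mul_left,
      ← ((S' (n + 1)).mul_left _).tsum_sub ((S' n).mul_left _)]
    refine tsum_congr fun j => ?_
    linear_combination s ^ (j + 1) * legendreQCoeff_rec_succ hμ n j
  have h0 := legendreQCoeff_rec_zero (μ := μ) n
  simp only [pow_zero, mul_one] at e1 e2 e3
  rw [sub_mul, one_mul, e2, e3]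
  nth_rewrite 1 [e1]
  linear_combination key + h0

/-- The Gegenbauer polynomial `C_n^μ(y)` for `y = 1 / T > 1`, as a hypergeometric series. -/
lemma gegenbauerC_eq_tsum {μ : ℝ} (hμ : 0 < μ) {y T : ℝ} (hT : 0 < T) (hT1 : T < 1)
    (hy : T * y = 1) (n : ℕ) :
    gegenbauerC n μ y =
      T ^ (2 * μ) * T ^ n * ∑' j, legendreQCoeff μ n j * (1 - T ^ 2) ^ j := by
  have hs : |1 - T ^ 2| < 1 := by rw [abs_lt]; constructor <;> nlinarith
  have hpow : ∀ ν : ℝ, (1 - (1 - T ^ 2)) ^ ν = T ^ (2 * ν) := fun ν => by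
    rw [sub_sub_cancel, ← Real.rpow_natCast, ← Real.rpow_mul hT.le]; norm_num
  -- Instead of a quadratic transformation, the recurrence and two initial values identify the
  -- series; for n = 0 and n = 1 it is a binomial series.
  have h := eq_gegenbauerC_of_recurrence (𝕜 := ℝ) hμ y (fun n =>
    T ^ (2 * μ) * T ^ n * ∑' j, legendreQCoeff μ n j * (1 - T ^ 2) ^ j) ?_ ?_ (fun n => ?_) n
  · simpa using h.symm
  · simp_rw [legendreQCoeff_zero hμ]
    rw [(hasSum_negBinomCoeff hs).tsum_eq, hpow, pow_zero, mul_one, ← Real.rpow_add hT]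
    simp
  · simp_rw [legendreQCoeff_one hμ, mul_assoc]
    rw [tsum_mul_left, tsum_mul_left, (hasSum_negBinomCoeff hs).tsum_eq, hpow, pow_one,
      show 2 * -(μ + 1) = -(2 * μ) - 2 by ring, Real.rpow_sub hT, Real.rpow_neg hT.le]
    have : y = 1 / T := by field_simp; linarith
    have hne := (Real.rpow_pos_of_pos hT (2 * μ)).ne'
    simp [this]
    field_simp
  · have h1 := tsum_legendreQCoeff_rec hμ n hs
    simp only [RCLike.ofReal_real_eq_id, id]
    rw [sub_sub_cancel] at h1
    linear_combination T ^ (2 * μ) * T ^ n * h1 -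
      2 * (n + 1 + μ) * T ^ (2 * μ) * T ^ n * (∑' j, legendreQCoeff μ (n + 1) j * (1 - T ^ 2) ^ j) * hy

lemma assocLegendreQ_eq (l : ℝ) {z : ℝ} (hz : 1 < z) (n : ℕ) :
    assocLegendreQ l (l + n) z = Complex.exp (Complex.I * Real.pi * ((l + n : ℝ) : ℂ)) *
      ((Real.sqrt Real.pi * Real.Gamma (2 * l + n + 1) * (z ^ 2 - 1) ^ ((l + n) / 2) /
      ((2 : ℝ) ^ (l + 1) * z ^ (2 * l + n + 1) * Real.Gamma (l + 3 / 2)) *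
      ₂F₁ (l + n / 2 + 1) (l + n / 2 + 1 / 2) (l + 3 / 2) (1 / z ^ 2) : ℝ) : ℂ) := by
  rw [assocLegendreQ, gaussF, if_pos (by positivity), show l + (l + (n : ℝ)) = 2 * l + n by ring,
    show (2 * l + (n : ℝ)) / 2 + 1 = l + n / 2 + 1 by ring,
    show (2 * l + (n : ℝ) + 1) / 2 = l + n / 2 + 1 / 2 by ring]

lemma Gamma_add_natCast {x : ℝ} (hx : 0 < x) (n : ℕ) :
    Real.Gamma (x + n) = (ascPochhammer ℝ n).eval x * Real.Gamma x := by
  induction n with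
  | zero => simp
  | succ n ih =>
    rw [Nat.cast_succ, ← add_assoc, Real.Gamma_add_one (by positivity), ih, ascPochhammer_succ_eval]
    ring

/-- With T = S/z, that is T = tanh s for z = cosh s, 1 - T² = 1/z², so the series defining Q is the
one in `gegenbauerC_eq_tsum` for order l + 1. The constants agree by the duplication formula for
Gamma. -/
lemma assocLegendreQ_succ {l z S : ℝ} (hl : 0 < l) (hS : 0 < S) (hz : 0 < z)
    (hzS : z ^ 2 = 1 + S ^ 2) (n : ℕ) :
    assocLegendreQ l (l + ((n + 1 : ℕ) : ℝ)) z =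
      Complex.exp (Complex.I * Real.pi * ((l + ((n + 1 : ℕ) : ℝ) : ℝ) : ℂ)) *
      (((2 : ℝ) ^ l * Real.Gamma (l + 1) * n.factorial * gegenbauerC n (l + 1) (z / S) /
        S ^ (l + 1) : ℝ) : ℂ) := by
  have hz1 : 1 < z := by nlinarith [sq_pos_of_pos hS]
  have hSz : S < z := by nlinarith
  rw [assocLegendreQ_eq l hz1]
  congr 2
  have hT : 1 - (S / z) ^ 2 = 1 / z ^ 2 := by field_simp; linarith
  rw [gegenbauerC_eq_tsum (by positivity : 0 < l + 1) (T := S / z) (by positivity)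
    ((div_lt_one hz).2 hSz) (by field_simp) n, hT]
  simp only [legendreQCoeff_eq, mul_assoc (_ / _ : ℝ)]
  have hs : |1 / z ^ 2| < 1 := by
    rw [abs_of_pos (by positivity), div_lt_one (by positivity)]; nlinarith
  rw [tsum_mul_left, (hasSum_gaussCoeff (by positivity) hs).tsum_eq]
  rw [show l + 1 + (n : ℝ) / 2 + 1 / 2 = l + ((n + 1 : ℕ) : ℝ) / 2 + 1 by push_cast; ring,
    show l + 1 + (n : ℝ) / 2 = l + ((n + 1 : ℕ) : ℝ) / 2 + 1 / 2 by push_cast; ring,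
    show l + 1 + 1 / 2 = l + 3 / 2 by ring]
  generalize ₂F₁ (l + ((n + 1 : ℕ) : ℝ) / 2 + 1) (l + ((n + 1 : ℕ) : ℝ) / 2 + 1 / 2)
    (l + 3 / 2) (1 / z ^ 2) = F
  have hdup := Real.Gamma_mul_Gamma_add_half (l + 1)
  rw [show l + 1 + 1 / 2 = l + 3 / 2 by ring] at hdup
  have hG : Real.Gamma (2 * l + ((n + 1 : ℕ) : ℝ) + 1) =
      (ascPochhammer ℝ n).eval (2 * (l + 1)) * Real.Gamma (2 * (l + 1)) := by
    rw [← Gamma_add_natCast (by positivity)]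
    congr 1
    push_cast
    ring
  have hg3 : Real.Gamma (l + 3 / 2) ≠ 0 := (Real.Gamma_pos_of_pos (by positivity)).ne'
  rw [hzS, add_sub_cancel_left, hG, ← Real.rpow_natCast S 2, ← Real.rpow_mul hS.le,
    show ((2 : ℕ) : ℝ) * ((l + ((n + 1 : ℕ) : ℝ)) / 2) = l + 1 + n by push_cast; ring,
    show 2 * l + ((n + 1 : ℕ) : ℝ) + 1 = 2 * (l + 1) + n by push_cast; ring,
    Real.rpow_add hS, Real.rpow_add hz, Real.rpow_natCast, Real.rpow_natCast,
    Real.div_rpow hS.le hz.le, div_pow, show 2 * (l + 1) = l + 1 + (l + 1) by ring,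
    Real.rpow_add hS (l + 1) (l + 1)]
  have h2 : (2 : ℝ) ^ (1 - 2 * (l + 1)) = 1 / ((2 : ℝ) ^ l * (2 : ℝ) ^ (l + 1)) := by
    rw [← Real.rpow_add two_pos, one_div, ← Real.rpow_neg two_pos.le]; congr 1; ring
  rw [h2, show 2 * (l + 1) = l + 1 + (l + 1) by ring] at hdup
  have p1 := (Real.rpow_pos_of_pos two_pos l).ne'
  have p2 := (Real.rpow_pos_of_pos two_pos (l + 1)).ne'
  have p3 := (Real.rpow_pos_of_pos hS (l + 1)).ne'
  have p4 := (Real.rpow_pos_of_pos hz (l + 1 + (l + 1))).ne'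
  generalize (2 : ℝ) ^ l = A1 at *
  generalize (2 : ℝ) ^ (l + 1) = A2 at *
  generalize S ^ (l + 1) = A3 at *
  generalize z ^ (l + 1 + (l + 1)) = A4 at *
  generalize (ascPochhammer ℝ n).eval (l + 1 + (l + 1)) = A5 at *
  generalize Real.Gamma (l + 3 / 2) = G3 at *
  generalize Real.Gamma (l + 1) = G1 at *
  generalize Real.Gamma (l + 1 + (l + 1)) = G2 at *
  field_simp at hdup ⊢
  linear_combination (-A5 * F) * hdup

end

section

open Finset Filter Topology MeasureTheory

/-! ### The radial integral and the Legendre function of degree zero in the expansion -/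

lemma hasDerivAt_neg_inv_cosh_pow (m : ℕ) (t : ℝ) :
    HasDerivAt (fun t => -(((m : ℝ) + 1) * Real.cosh t ^ (m + 1))⁻¹)
      (Real.sinh t / Real.cosh t ^ (m + 2)) t := by
  have hc := (Real.cosh_pos t).ne'
  have h := ((((Real.hasDerivAt_cosh t).pow (m + 1)).const_mul ((m : ℝ) + 1)).inv
    (by simp only [Pi.pow_apply]; positivity)).neg
  refine h.congr_deriv ?_
  simp only [Pi.pow_apply, Nat.add_sub_cancel]
  push_cast
  field_simp
  ring

lemma tendsto_neg_inv_cosh_pow (m : ℕ) :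
    Tendsto (fun t => -(((m : ℝ) + 1) * Real.cosh t ^ (m + 1))⁻¹) atTop (𝓝 0) := by
  rw [← neg_zero]
  refine (Tendsto.inv_tendsto_atTop ?_).neg
  refine Tendsto.const_mul_atTop (by positivity) ?_
  refine (tendsto_pow_atTop (by omega)).comp ?_
  refine tendsto_atTop_mono (fun t => ?_) (Real.tendsto_exp_atTop.atTop_div_const two_pos)
  rw [Real.cosh_eq]
  have := Real.exp_pos (-t)
  linarith

lemma integrableOn_sinh_div_cosh_pow (m : ℕ) {ρ : ℝ} (hρ : 0 < ρ) :
    IntegrableOn (fun t => Real.sinh t / Real.cosh t ^ (m + 2)) (Set.Ioi ρ) := by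
  refine integrableOn_Ioi_deriv_of_nonneg' (fun t _ => hasDerivAt_neg_inv_cosh_pow m t)
    (fun t ht => ?_) (tendsto_neg_inv_cosh_pow m)
  have : 0 < Real.sinh t := Real.sinh_pos_iff.2 (hρ.trans ht)
  have := Real.cosh_pos t
  positivity

lemma integral_sinh_div_cosh_pow (m : ℕ) {ρ : ℝ} (hρ : 0 < ρ) :
    ∫ t in Set.Ioi ρ, Real.sinh t / Real.cosh t ^ (m + 2) =
      (((m : ℝ) + 1) * Real.cosh ρ ^ (m + 1))⁻¹ := by
  rw [integral_Ioi_of_hasDerivAt_of_nonneg' (fun t _ => hasDerivAt_neg_inv_cosh_pow m t)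
    (fun t ht => ?_) (tendsto_neg_inv_cosh_pow m)]
  · ring
  have : 0 < Real.sinh t := Real.sinh_pos_iff.2 (hρ.trans ht)
  have := Real.cosh_pos t
  positivity

/-- Write sinh t · sinh^(-(d+2)) t and expand (1 - 1/cosh² t)^(-(d+2)/2) binomially; the spare
factor sinh t gives each term an elementary primitive. Here d stands for the dimension minus 2. -/
lemma hasSum_inv_sinh_pow (d : ℕ) {t : ℝ} (ht : 0 < t) :
    HasSum (fun n : ℕ => negBinomCoeff (((d + 2 : ℕ) : ℝ) / 2) n *
      (Real.sinh t / Real.cosh t ^ (2 * n + d + 2))) (1 / Real.sinh t ^ (d + 1)) := by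
  have hs := Real.sinh_pos_iff.2 ht
  have hc := Real.cosh_pos t
  have hcs := Real.cosh_sq t
  have hx : |1 / Real.cosh t ^ 2| < 1 := by
    rw [abs_of_pos (by positivity), div_lt_one (by positivity), hcs]
    have : 0 < Real.sinh t ^ 2 := by positivity
    linarith
  have h := (hasSum_negBinomCoeff (μ := ((d + 2 : ℕ) : ℝ) / 2) hx).mul_left
    (Real.sinh t / Real.cosh t ^ (d + 2))
  have e : 1 - 1 / Real.cosh t ^ 2 = (Real.sinh t / Real.cosh t) ^ 2 := by
    field_simp; linarith
  rw [e, ← Real.rpow_natCast (Real.sinh t / Real.cosh t) 2, ← Real.rpow_mul (by positivity),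
    show ((2 : ℕ) : ℝ) * -(((d + 2 : ℕ) : ℝ) / 2) = -((d + 2 : ℕ) : ℝ) by push_cast; ring,
    Real.rpow_neg (by positivity), Real.rpow_natCast] at h
  have e2 : Real.sinh t / Real.cosh t ^ (d + 2) * ((Real.sinh t / Real.cosh t) ^ (d + 2))⁻¹ =
      1 / Real.sinh t ^ (d + 1) := by
    rw [div_pow]; field_simp; ring
  rw [e2] at h
  refine h.congr_fun fun n => ?_
  rw [one_div, inv_pow, ← pow_mul]
  field_simp
  ring

lemma integrableOn_inv_sinh_pow (d : ℕ) (hd : 3 ≤ d) {ρ : ℝ} (hρ : 0 < ρ) :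
    IntegrableOn (fun t => 1 / Real.sinh t ^ (d - 1)) (Set.Ioi ρ) := by
  have hg : ∀ t ∈ Set.Ici ρ, HasDerivAt (fun t => -(Real.sinh t)⁻¹)
      (Real.cosh t / Real.sinh t ^ 2) t := fun t ht => by
    have hs : 0 < Real.sinh t := Real.sinh_pos_iff.2 (hρ.trans_le ht)
    refine ((Real.hasDerivAt_sinh t).inv hs.ne').neg.congr_deriv ?_
    ring
  have hlim : Tendsto (fun t => -(Real.sinh t)⁻¹) atTop (𝓝 0) := by
    rw [← neg_zero]
    refine (Tendsto.inv_tendsto_atTop ?_).neg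
    exact tendsto_atTop_mono' _ ((eventually_ge_atTop 0).mono fun t ht => Real.self_le_sinh_iff.2 ht)
      tendsto_id
  have hint := integrableOn_Ioi_deriv_of_nonneg' hg (fun t ht => by
    have := Real.cosh_pos t
    positivity) hlim
  -- The majorant splits d - 1 = (d - 3) + 2, freezes the first power at ρ, and uses cosh ≥ 1 to
  -- reach the derivative of -1/sinh.
  have h2 := hint.const_mul (1 / Real.sinh ρ ^ (d - 3))
  have hpos : ∀ t ∈ Set.Ioi ρ, 0 < Real.sinh t := fun t ht => Real.sinh_pos_iff.2 (hρ.trans ht)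
  refine Integrable.mono' h2 ?_ ?_
  · refine ContinuousOn.aestronglyMeasurable ?_ measurableSet_Ioi
    refine continuousOn_const.div (by fun_prop) fun t ht => ?_
    exact pow_ne_zero _ (hpos t ht).ne'
  · refine (ae_restrict_iff' measurableSet_Ioi).2 (Eventually.of_forall fun t ht => ?_)
    have h3 := hpos t ht
    have h4 : 0 < Real.sinh ρ := Real.sinh_pos_iff.2 hρ
    have h5 : Real.sinh ρ ≤ Real.sinh t := Real.sinh_le_sinh.2 (le_of_lt ht)
    rw [Real.norm_of_nonneg (by positivity), show d - 1 = (d - 3) + 2 by omega, pow_add,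
      div_mul_div_comm, one_mul]
    have := Real.one_le_cosh t
    gcongr

/-- `I_d(ρ)` as a hypergeometric series in `1 / cosh² ρ`. -/
lemma fundIntegral_eq (d : ℕ) (hd : 3 ≤ d) {ρ : ℝ} (hρ : 0 < ρ) :
    fundIntegral d ρ = 1 / (((d : ℝ) - 1) * Real.cosh ρ ^ (d - 1)) *
      ₂F₁ ((d : ℝ) / 2) (((d : ℝ) - 1) / 2) (((d : ℝ) + 1) / 2) (1 / Real.cosh ρ ^ 2) := by
  obtain ⟨d, rfl⟩ : ∃ e, d = e + 2 := ⟨d - 2, by omega⟩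
  have hd1 : 1 ≤ d := by omega
  have hc := Real.cosh_pos ρ
  have hx : |1 / Real.cosh ρ ^ 2| < 1 := by
    rw [abs_of_pos (by positivity), div_lt_one (by positivity), Real.cosh_sq]
    have : 0 < Real.sinh ρ := Real.sinh_pos_iff.2 hρ
    have : 0 < Real.sinh ρ ^ 2 := by positivity
    linarith
  have hpos : ∀ n : ℕ, 0 < negBinomCoeff (((d + 2 : ℕ) : ℝ) / 2) n := fun n =>
    negBinomCoeff_pos (by positivity) n
  have hterm : ∀ n : ℕ, ∫ t in Set.Ioi ρ, negBinomCoeff (((d + 2 : ℕ) : ℝ) / 2) n *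
      (Real.sinh t / Real.cosh t ^ (2 * n + d + 2)) =
      1 / ((((d + 2 : ℕ) : ℝ) - 1) * Real.cosh ρ ^ (d + 1)) *
        (gaussCoeff (((d + 2 : ℕ) : ℝ) / 2) ((((d + 2 : ℕ) : ℝ) - 1) / 2)
          ((((d + 2 : ℕ) : ℝ) + 1) / 2) n * (1 / Real.cosh ρ ^ 2) ^ n) := fun n => by
    rw [integral_const_mul, integral_sinh_div_cosh_pow _ hρ]
    have h0 : 0 < (((d + 2 : ℕ) : ℝ) - 1) / 2 := by push_cast; linarith [d.cast_nonneg (α := ℝ)]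
    have h1 : (ascPochhammer ℝ n).eval ((((d + 2 : ℕ) : ℝ) - 1) / 2) /
        (ascPochhammer ℝ n).eval ((((d + 2 : ℕ) : ℝ) + 1) / 2) =
        (((d + 2 : ℕ) : ℝ) - 1) / ((2 * n + d : ℕ) + 1) := by
      have e1 := ascPochhammer_eval_succ_left ((((d + 2 : ℕ) : ℝ) - 1) / 2) n
      rw [ascPochhammer_succ_eval,
        show (((d + 2 : ℕ) : ℝ) - 1) / 2 + 1 = (((d + 2 : ℕ) : ℝ) + 1) / 2 by ring] at e1
      have h2 := ascPochhammer_eval_ne_zero (x := (((d + 2 : ℕ) : ℝ) + 1) / 2) (by positivity) n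
      rw [div_eq_div_iff h2 (by positivity)]
      push_cast at e1 ⊢
      linear_combination 2 * e1
    rw [gaussCoeff, ordinaryHypergeometricCoefficient, negBinomCoeff,
      mul_assoc _ _ (_)⁻¹, ← div_eq_mul_inv (Polynomial.eval _ _) (Polynomial.eval _ _), h1,
      one_div, one_div, inv_pow, ← pow_mul]
    have h3 : (((d + 2 : ℕ) : ℝ) - 1) ≠ 0 := by linarith
    field_simp
    ring
  have hsum := (hasSum_gaussCoeff (a := ((d + 2 : ℕ) : ℝ) / 2) (b := (((d + 2 : ℕ) : ℝ) - 1) / 2)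
    (c := (((d + 2 : ℕ) : ℝ) + 1) / 2) (by positivity) hx).mul_left
      (1 / ((((d + 2 : ℕ) : ℝ) - 1) * Real.cosh ρ ^ (d + 1)))
  simp_rw [← hterm] at hsum
  -- The terms are nonnegative, so their integrals are the integrals of their norms, and these sum
  -- by convergence of the Gauss series at 1/cosh² ρ < 1.
  have hmain := hasSum_integral_of_summable_integral_norm (μ := volume.restrict (Set.Ioi ρ))
    (F := fun n t => negBinomCoeff (((d + 2 : ℕ) : ℝ) / 2) n *
      (Real.sinh t / Real.cosh t ^ (2 * n + d + 2)))
    (fun n => (integrableOn_sinh_div_cosh_pow _ hρ).const_mul _) (by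
      refine hsum.summable.congr fun n => ?_
      refine setIntegral_congr_fun measurableSet_Ioi fun t ht => ?_
      have := Real.sinh_pos_iff.2 (hρ.trans ht)
      have := Real.cosh_pos t
      have := hpos n
      exact (Real.norm_of_nonneg (by positivity)).symm)
  rw [fundIntegral, show d + 2 - 1 = d + 1 by omega, ← hmain.unique hsum]
  refine setIntegral_congr_fun measurableSet_Ioi fun t ht => ?_
  exact (hasSum_inv_sinh_pow d (hρ.trans ht)).tsum_eq.symm

lemma assocLegendreQ_zero (d : ℕ) (hd : 3 ≤ d) {ρ : ℝ} (hρ : 0 < ρ) :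
    assocLegendreQ ((d : ℝ) / 2 - 1) ((d : ℝ) / 2 - 1) (Real.cosh ρ) =
      Complex.exp (Complex.I * Real.pi * (((d : ℝ) / 2 - 1 : ℝ) : ℂ)) *
      (((2 : ℝ) ^ ((d : ℝ) / 2 - 1) * Real.Gamma ((d : ℝ) / 2) *
        Real.sinh ρ ^ ((d : ℝ) / 2 - 1) * fundIntegral d ρ : ℝ) : ℂ) := by
  have hd' : (3 : ℝ) ≤ d := by exact_mod_cast hd
  have hz : 1 < Real.cosh ρ := Real.one_lt_cosh.2 hρ.ne'
  have hS : 0 < Real.sinh ρ := Real.sinh_pos_iff.2 hρ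
  have h := assocLegendreQ_eq ((d : ℝ) / 2 - 1) hz 0
  simp only [Nat.cast_zero, add_zero, zero_div] at h
  rw [h, fundIntegral_eq d hd hρ]
  congr 2
  rw [show (d : ℝ) / 2 - 1 + 1 = d / 2 by ring, show (d : ℝ) / 2 - 1 + 1 / 2 = (d - 1) / 2 by ring,
    show (d : ℝ) / 2 - 1 + 3 / 2 = (d + 1) / 2 by ring,
    show 2 * ((d : ℝ) / 2 - 1) + 1 = ((d - 1 : ℕ) : ℝ) by
      rw [Nat.cast_sub (by omega)]; push_cast; ring, Real.rpow_natCast]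
  generalize ₂F₁ ((d : ℝ) / 2) (((d : ℝ) - 1) / 2) (((d : ℝ) + 1) / 2) (1 / Real.cosh ρ ^ 2) = F
  rw [Real.cosh_sq, add_sub_cancel_right, ← Real.rpow_natCast (Real.sinh ρ) 2,
    ← Real.rpow_mul hS.le, show ((2 : ℕ) : ℝ) * (((d : ℝ) / 2 - 1) / 2) = d / 2 - 1 by
      push_cast; ring]
  have hdup := Real.Gamma_mul_Gamma_add_half ((d : ℝ) / 2)
  have hG := Real.Gamma_add_one (s := ((d - 1 : ℕ) : ℝ)) (by
    have : d - 1 ≠ 0 := by omega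
    exact_mod_cast this)
  have e1 : ((d - 1 : ℕ) : ℝ) = d - 1 := by rw [Nat.cast_sub (by omega)]; simp
  rw [show (d : ℝ) / 2 + 1 / 2 = (d + 1) / 2 by ring,
    show 2 * ((d : ℝ) / 2) = ((d - 1 : ℕ) : ℝ) + 1 by rw [e1]; ring, hG,
    show 1 - (((d - 1 : ℕ) : ℝ) + 1) = -((d : ℝ) / 2 - 1) - d / 2 by rw [e1]; ring,
    Real.rpow_sub two_pos, Real.rpow_neg two_pos.le] at hdup
  have hg3 : Real.Gamma (((d : ℝ) + 1) / 2) ≠ 0 := (Real.Gamma_pos_of_pos (by positivity)).ne'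
  have p1 := (Real.rpow_pos_of_pos two_pos ((d : ℝ) / 2 - 1)).ne'
  have p2 := (Real.rpow_pos_of_pos two_pos ((d : ℝ) / 2)).ne'
  have p4 : (Real.cosh ρ) ^ (d - 1) ≠ 0 := by positivity
  have p5 : (d : ℝ) - 1 ≠ 0 := by linarith
  rw [e1] at hdup ⊢
  generalize (2 : ℝ) ^ ((d : ℝ) / 2 - 1) = A1 at *
  generalize (2 : ℝ) ^ ((d : ℝ) / 2) = A2 at *
  generalize Real.sinh ρ ^ ((d : ℝ) / 2 - 1) = A3 at *
  generalize Real.cosh ρ ^ (d - 1) = A4 at *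
  generalize Real.Gamma (((d : ℝ) + 1) / 2) = G3 at *
  generalize Real.Gamma ((d : ℝ) / 2) = G1 at *
  generalize Real.Gamma ((d : ℝ) - 1) = G2 at *
  field_simp at hdup ⊢
  linear_combination (-A3 * F) * hdup

lemma hasDerivAt_fundIntegral (d : ℕ) (hd : 3 ≤ d) {ρ : ℝ} (hρ : 0 < ρ) :
    HasDerivAt (fundIntegral d) (-(1 / Real.sinh ρ ^ (d - 1))) ρ := by
  have hρ2 : 0 < ρ / 2 := by positivity
  have hcont : ∀ t > 0, ContinuousAt (fun t => 1 / Real.sinh t ^ (d - 1)) t := fun t ht => by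
    have := Real.sinh_pos_iff.2 ht
    exact continuousAt_const.div (by fun_prop) (by positivity)
  have hint : IntervalIntegrable (fun t => 1 / Real.sinh t ^ (d - 1)) volume (ρ / 2) ρ := by
    refine ContinuousOn.intervalIntegrable fun t ht => (hcont t ?_).continuousWithinAt
    rw [Set.uIcc_of_le (by linarith)] at ht
    linarith [ht.1]
  have h1 := (intervalIntegral.integral_hasDerivAt_right hint
    (ContinuousAt.stronglyMeasurableAtFilter isOpen_Ioi (s := Set.Ioi 0) (fun t ht => hcont t ht)
      ρ hρ) (hcont ρ hρ)).const_sub (fundIntegral d (ρ / 2))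
  refine h1.congr_of_eventuallyEq ?_
  filter_upwards [lt_mem_nhds hρ] with s hs
  rw [← intervalIntegral.integral_Ioi_sub_Ioi' (integrableOn_inv_sinh_pow d hd hρ2)
    (integrableOn_inv_sinh_pow d hd hs)]
  simp [fundIntegral]

/-- In the variable z = cosh ρ, the chain rule contributes one more factor 1/sinh ρ, which leaves a
pure power of z² - 1. -/
lemma hasDerivAt_fundIntegral_arcosh (d : ℕ) (hd : 3 ≤ d) {z : ℝ} (hz : 1 < z) :
    HasDerivAt (fun z => fundIntegral d (Real.arcosh z)) (-(z ^ 2 - 1) ^ (-((d : ℝ) / 2))) z := by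
  have h := (hasDerivAt_fundIntegral d hd (Real.arcosh_pos hz)).comp z (Real.hasDerivAt_arcosh hz)
  refine h.congr_deriv ?_
  have hpos : 0 < z ^ 2 - 1 := by nlinarith
  have h2 : (z ^ 2 - 1) ^ ((d : ℝ) / 2) = √(z ^ 2 - 1) ^ d := by
    rw [Real.sqrt_eq_rpow, ← Real.rpow_natCast (_ ^ _) d, ← Real.rpow_mul hpos.le]; congr 1; ring
  have h3 : √(z ^ 2 - 1) ≠ 0 := (Real.sqrt_pos.2 hpos).ne'
  rw [Real.sinh_arcosh hz.le, Real.rpow_neg hpos.le, h2]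
  obtain ⟨e, rfl⟩ : ∃ e, d = e + 1 := ⟨d - 1, by omega⟩
  rw [Nat.add_sub_cancel, pow_succ]
  field_simp
  ring

/-! ### Mean value property of the fundamental solution -/

/-- `cosh` of the distance between points with polar coordinates `r`, `s` and angle `arccos c`. -/
noncomputable def coshDist (r s c : ℝ) : ℝ :=
  Real.cosh r * Real.cosh s - Real.sinh r * Real.sinh s * c

/-- The Gegenbauer weight `(1 - c²)^((d - 3) / 2)`. -/
noncomputable def gegenbauerWeight (d : ℕ) (c : ℝ) : ℝ := (1 - c ^ 2) ^ (((d : ℝ) - 3) / 2)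

lemma continuous_gegenbauerWeight {d : ℕ} (hd : 3 ≤ d) : Continuous (gegenbauerWeight d) := by
  have hd' : (3 : ℝ) ≤ d := by exact_mod_cast hd
  exact (by fun_prop : Continuous fun c : ℝ => 1 - c ^ 2).rpow_const
    fun _ => Or.inr (by linarith)

lemma one_lt_coshDist {r s c : ℝ} (hr : 0 ≤ r) (hrs : r < s) (hc : c ≤ 1) :
    1 < coshDist r s c := by
  have h1 : 1 < Real.cosh (s - r) := Real.one_lt_cosh.2 (by linarith)
  rw [Real.cosh_sub] at h1
  have h2 : 0 ≤ Real.sinh r := Real.sinh_nonneg_iff.2 hr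
  have h3 : 0 ≤ Real.sinh s := Real.sinh_nonneg_iff.2 (by linarith)
  have h4 := mul_le_mul_of_nonneg_left hc (mul_nonneg h2 h3)
  unfold coshDist
  linarith

lemma hasDerivAt_coshDist_left (r s c : ℝ) :
    HasDerivAt (fun r => coshDist r s c)
      (Real.sinh r * Real.cosh s - Real.cosh r * Real.sinh s * c) r :=
  ((Real.hasDerivAt_cosh r).mul_const _).sub (((Real.hasDerivAt_sinh r).mul_const _).mul_const _)

lemma hasDerivAt_coshDist_right (r s c : ℝ) :
    HasDerivAt (fun c => coshDist r s c) (-(Real.sinh r * Real.sinh s)) c := by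
  have h := ((hasDerivAt_id c).const_mul (Real.sinh r * Real.sinh s)).const_sub
    (Real.cosh r * Real.cosh s)
  rw [mul_one] at h
  exact h

/-- The flux of the gradient of the fundamental solution through a sphere that does not enclose the
pole vanishes. -/
lemma integral_flux_eq_zero {d : ℕ} (hd : 3 ≤ d) {r s : ℝ} (hr : 0 < r) (hrs : r < s) :
    ∫ c in (-1 : ℝ)..1, (coshDist r s c ^ 2 - 1) ^ (-((d : ℝ) / 2)) *
      (Real.sinh r * Real.cosh s - Real.cosh r * Real.sinh s * c) * gegenbauerWeight d c = 0 := by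
  have hS : 0 < Real.sinh r := Real.sinh_pos_iff.2 hr
  -- By the hyperbolic law of cosines, `u c` is the cosine of the angle at the pole in the triangle
  -- with sides r and s. The flux is, up to a constant, the derivative of the solid-angle function
  -- `A (u c)`. As the pole lies outside the sphere (r < s), this angle is 0 at both c = 1 and c =
  -- -1, and the total flux cancels.
  set E : ℝ → ℝ := fun c => Real.sinh s * Real.cosh r - Real.cosh s * Real.sinh r * c with hE
  set u : ℝ → ℝ := fun c => E c / √(coshDist r s c ^ 2 - 1) with hu
  set A : ℝ → ℝ := fun x => ∫ t in (0 : ℝ)..x, gegenbauerWeight d t with hA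
  have hZ : ∀ c ≤ (1 : ℝ), 0 < coshDist r s c ^ 2 - 1 := fun c hc => by
    nlinarith [one_lt_coshDist hr.le hrs hc]
  have hAd : ∀ x, HasDerivAt A (gegenbauerWeight d x) x := fun x =>
    (continuous_gegenbauerWeight hd).integral_hasStrictDerivAt 0 x |>.hasDerivAt
  have hEd : ∀ c, HasDerivAt E (-(Real.cosh s * Real.sinh r)) c := fun c => by
    have h := ((hasDerivAt_id c).const_mul (Real.cosh s * Real.sinh r)).const_sub
      (Real.sinh s * Real.cosh r)
    rw [mul_one] at h
    exact h
  have hud : ∀ c ∈ Set.Icc (-1 : ℝ) 1, HasDerivAt u (-(Real.sinh r ^ 2 *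
      (Real.sinh r * Real.cosh s - Real.cosh r * Real.sinh s * c)) /
        √(coshDist r s c ^ 2 - 1) ^ 3) c := fun c hc => by
    have hz := hZ c hc.2
    have hq := Real.sqrt_pos.2 hz
    have h1 := (((hasDerivAt_coshDist_right r s c).pow 2).sub_const 1).sqrt hz.ne'
    refine ((hEd c).div h1 hq.ne').congr_deriv ?_
    have hsq := Real.sq_sqrt hz.le
    simp only [Pi.pow_apply] at hq ⊢
    set q := √(coshDist r s c ^ 2 - 1)
    have h2 := Real.cosh_sq r
    have h3 := Real.cosh_sq s
    have key : -(Real.cosh s * Real.sinh r) * q ^ 2 + E c * coshDist r s c *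
        (Real.sinh r * Real.sinh s) = -(Real.sinh r ^ 2 *
          (Real.sinh r * Real.cosh s - Real.cosh r * Real.sinh s * c)) := by
      rw [hsq]
      simp only [hE, coshDist]
      linear_combination (-(Real.sinh r * Real.cosh r * (Real.cosh r * Real.cosh s -
        Real.sinh r * Real.sinh s * c))) * h3 - Real.sinh r * Real.cosh s * h2
    push_cast
    field_simp
    refine mul_left_cancel₀ hS.ne' ?_
    linear_combination key
  have hsq1 : ∀ c ∈ Set.Icc (-1 : ℝ) 1, gegenbauerWeight d (u c) = Real.sinh r ^ ((d : ℝ) - 3) *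
      gegenbauerWeight d c * (coshDist r s c ^ 2 - 1) ^ (-(((d : ℝ) - 3) / 2)) := fun c hc => by
    have hz := hZ c hc.2
    have hc' : 0 ≤ 1 - c ^ 2 := by nlinarith [hc.1, hc.2]
    have h2 := Real.cosh_sq r
    have h3 := Real.cosh_sq s
    -- The hyperbolic law of sines, squared.
    have h1 : 1 - u c ^ 2 = Real.sinh r ^ 2 * (1 - c ^ 2) * (coshDist r s c ^ 2 - 1)⁻¹ := by
      simp only [hu]
      rw [div_pow, Real.sq_sqrt hz.le]
      field_simp
      simp only [hE, coshDist]
      linear_combination (Real.cosh r ^ 2 - Real.sinh r ^ 2 * c ^ 2) * h3 + h2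
    rw [gegenbauerWeight, h1, Real.mul_rpow (by positivity) (by positivity),
      Real.mul_rpow (by positivity) hc', Real.inv_rpow hz.le, ← Real.rpow_neg hz.le,
      ← Real.rpow_natCast (Real.sinh r) 2, ← Real.rpow_mul hS.le, gegenbauerWeight]
    congr 4
    push_cast; ring
  have hcomp : ∀ c ∈ Set.Icc (-1 : ℝ) 1, HasDerivAt (fun c => A (u c))
      (-Real.sinh r ^ ((d : ℝ) - 1) * ((coshDist r s c ^ 2 - 1) ^ (-((d : ℝ) / 2)) *
      (Real.sinh r * Real.cosh s - Real.cosh r * Real.sinh s * c) * gegenbauerWeight d c)) c := by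
    intro c hc
    have hz := hZ c hc.2
    refine ((hAd (u c)).comp c (hud c hc)).congr_deriv ?_
    have h3 : √(coshDist r s c ^ 2 - 1) ^ 3 = (coshDist r s c ^ 2 - 1) ^ ((3 : ℝ) / 2) := by
      rw [Real.sqrt_eq_rpow, ← Real.rpow_natCast (_ ^ _) 3, ← Real.rpow_mul hz.le]
      congr 1; norm_num
    have h4 : Real.sinh r ^ ((d : ℝ) - 1) = Real.sinh r ^ ((d : ℝ) - 3) * Real.sinh r ^ 2 := by
      rw [← Real.rpow_natCast (Real.sinh r) 2, ← Real.rpow_add hS]; congr 1; push_cast; ring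
    rw [hsq1 c hc, h3, h4, div_eq_mul_inv (-(Real.sinh r ^ 2 * _)), ← Real.rpow_neg hz.le,
      show -((d : ℝ) / 2) = -(((d : ℝ) - 3) / 2) + -((3 : ℝ) / 2) by ring, Real.rpow_add hz]
    ring
  have hcont : Continuous fun c : ℝ => coshDist r s c := by unfold coshDist; fun_prop
  have hint : IntervalIntegrable (fun c => -Real.sinh r ^ ((d : ℝ) - 1) *
      ((coshDist r s c ^ 2 - 1) ^ (-((d : ℝ) / 2)) *
      (Real.sinh r * Real.cosh s - Real.cosh r * Real.sinh s * c) * gegenbauerWeight d c))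
      volume (-1) 1 := by
    refine ContinuousOn.intervalIntegrable ?_
    rw [Set.uIcc_of_le (by norm_num)]
    refine continuousOn_const.mul (((ContinuousOn.rpow_const (by fun_prop) fun c hc =>
      Or.inl (hZ c hc.2).ne').mul (by fun_prop)).mul (continuous_gegenbauerWeight hd).continuousOn)
  have hFTC := intervalIntegral.integral_eq_sub_of_hasDerivAt (a := -1) (b := 1) (fun c hc =>
    hcomp c (by rwa [Set.uIcc_of_le (by norm_num)] at hc)) hint
  have hone : u 1 = 1 := by
    have h1 : coshDist r s 1 = Real.cosh (s - r) := by rw [Real.cosh_sub, coshDist]; ring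
    have h2 : E 1 = Real.sinh (s - r) := by rw [Real.sinh_sub]; simp only [hE]; ring
    have h3 : 0 < Real.sinh (s - r) := Real.sinh_pos_iff.2 (by linarith)
    simp only [hu]
    rw [h1, h2, Real.cosh_sq, add_sub_cancel_right, Real.sqrt_sq h3.le, div_self h3.ne']
  have hneg : u (-1) = 1 := by
    have h1 : coshDist r s (-1) = Real.cosh (s + r) := by rw [Real.cosh_add, coshDist]; ring
    have h2 : E (-1) = Real.sinh (s + r) := by rw [Real.sinh_add]; simp only [hE]; ring
    have h3 : 0 < Real.sinh (s + r) := Real.sinh_pos_iff.2 (by linarith)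
    simp only [hu]
    rw [h1, h2, Real.cosh_sq, add_sub_cancel_right, Real.sqrt_sq h3.le, div_self h3.ne']
  rw [hone, hneg, sub_self, intervalIntegral.integral_const_mul] at hFTC
  exact (mul_eq_zero.1 hFTC).resolve_left
    (neg_ne_zero.2 (Real.rpow_pos_of_pos hS _).ne')

/-- The mean value property of the fundamental solution. -/
lemma integral_fundIntegral_mul_weight {d : ℕ} (hd : 3 ≤ d) {r s : ℝ} (hr : 0 < r) (hrs : r < s) :
    ∫ c in (-1 : ℝ)..1, fundIntegral d (Real.arcosh (coshDist r s c)) * gegenbauerWeight d c =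
      fundIntegral d s * ∫ c in (-1 : ℝ)..1, gegenbauerWeight d c := by
  set F : ℝ → ℝ → ℝ := fun c t => (coshDist t s c ^ 2 - 1) ^ (-((d : ℝ) / 2)) *
    (Real.sinh t * Real.cosh s - Real.cosh t * Real.sinh s * c) * gegenbauerWeight d c with hF
  have hZ : ∀ t ∈ Set.Icc 0 r, ∀ c ≤ (1 : ℝ), 1 < coshDist t s c := fun t ht c hc =>
    one_lt_coshDist ht.1 (ht.2.trans_lt hrs) hc
  have hZ' : ∀ t ∈ Set.Icc 0 r, ∀ c ≤ (1 : ℝ), coshDist t s c ^ 2 - 1 ≠ 0 := fun t ht c hc => by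
    nlinarith [hZ t ht c hc]
  have hw := continuous_gegenbauerWeight hd
  have hFcont : ContinuousOn F.uncurry (Set.Icc (-1) 1 ×ˢ Set.Icc 0 r) := by
    have e : F.uncurry = fun p : ℝ × ℝ => (coshDist p.2 s p.1 ^ 2 - 1) ^ (-((d : ℝ) / 2)) *
      (Real.sinh p.2 * Real.cosh s - Real.cosh p.2 * Real.sinh s * p.1) *
        gegenbauerWeight d p.1 := rfl
    rw [e]
    refine (ContinuousOn.mul (ContinuousOn.rpow_const ?_ fun p hp =>
      Or.inl (hZ' _ hp.2 _ hp.1.2)) (by fun_prop)).mul (hw.comp continuous_fst).continuousOn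
    unfold coshDist
    fun_prop
  have hinner : ∀ c ∈ Set.Icc (-1 : ℝ) 1, ∫ t in (0 : ℝ)..r, F c t =
      (fundIntegral d s - fundIntegral d (Real.arcosh (coshDist r s c))) *
        gegenbauerWeight d c := by
    intro c hc
    have hd : ∀ t ∈ Set.uIcc 0 r, HasDerivAt
        (fun t => -(fundIntegral d (Real.arcosh (coshDist t s c)) * gegenbauerWeight d c))
        (F c t) t := fun t ht => by
      rw [Set.uIcc_of_le hr.le] at ht
      refine ((((hasDerivAt_fundIntegral_arcosh d hd (hZ t ht c hc.2)).comp t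
        (hasDerivAt_coshDist_left t s c)).mul_const (gegenbauerWeight d c)).neg).congr_deriv ?_
      simp only [hF]; ring
    have hi : IntervalIntegrable (F c) volume 0 r := by
      refine ContinuousOn.intervalIntegrable ?_
      rw [Set.uIcc_of_le hr.le]
      exact hFcont.comp (f := fun t => (c, t)) (by fun_prop) fun t ht => ⟨hc, ht⟩
    rw [intervalIntegral.integral_eq_sub_of_hasDerivAt hd hi]
    have h0 : coshDist 0 s c = Real.cosh s := by simp [coshDist]
    rw [h0, Real.arcosh_cosh (by linarith)]
    ring
  have hswap := intervalIntegral_intervalIntegral_swap (F := F) (a := -1) (b := 1) (c := 0) (d := r)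
    ((hFcont.integrableOn_compact (isCompact_Icc.prod isCompact_Icc)).mono_set (by
      rw [Set.uIoc_of_le (by norm_num), Set.uIoc_of_le hr.le]
      exact Set.prod_mono Set.Ioc_subset_Icc_self Set.Ioc_subset_Icc_self))
  -- The inner integral is the radial derivative of the weighted mean, up to sign. Integrating it
  -- from radius 0, where the kernel is I_d(s) for every c, gives the claim; the interval is
  -- half-open at 0, so t > 0 is available.
  have hzero : ∫ t in (0 : ℝ)..r, ∫ c in (-1 : ℝ)..1, F c t = 0 := by
    refine intervalIntegral.integral_zero_ae (Eventually.of_forall fun t ht => ?_)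
    rw [Set.uIoc_of_le hr.le] at ht
    exact integral_flux_eq_zero hd ht.1 (ht.2.trans_lt hrs)
  rw [hzero, intervalIntegral.integral_congr (g := fun c => fundIntegral d s * gegenbauerWeight d c -
    fundIntegral d (Real.arcosh (coshDist r s c)) * gegenbauerWeight d c) (fun c hc => by
      rw [Set.uIcc_of_le (by norm_num)] at hc
      simp only [hinner c hc]; ring), intervalIntegral.integral_sub,
    intervalIntegral.integral_const_mul] at hswap
  · linarith
  · exact (continuous_const.mul hw).intervalIntegrable _ _
  · refine ContinuousOn.intervalIntegrable fun c hc => ?_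
    rw [Set.uIcc_of_le (by norm_num)] at hc
    have h1 : ContinuousAt (fun c => fundIntegral d (Real.arcosh (coshDist r s c))) c :=
      ((hasDerivAt_fundIntegral_arcosh d hd (hZ r ⟨hr.le, le_rfl⟩ c hc.2)).comp c
        (hasDerivAt_coshDist_right r s c)).continuousAt
    exact (h1.mul hw.continuousAt).continuousWithinAt

/-! ### Expansion of the derivative with respect to cos γ -/

lemma negBinomCoeff_mul_linearizationRatio {μ : ℝ} (hμ : 0 < μ) (n k : ℕ) :
    negBinomCoeff μ k * linearizationRatio μ n k =
      (n.factorial * (n + μ) / (ascPochhammer ℝ (n + 1)).eval μ) *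
        gaussCoeff μ (2 * μ + n) (μ + n + 1) k := by
  have h1 := ascPochhammer_eval_ne_zero (x := 2 * μ) (by positivity) n
  have h2 := ascPochhammer_eval_ne_zero hμ (n + 1)
  have h3 := ascPochhammer_eval_ne_zero (x := μ + n + 1) (by positivity) k
  have h4 := ascPochhammer_eval_ne_zero hμ (n + k)
  have h5 : (ascPochhammer ℝ (n + k)).eval μ * (n + k + μ) =
      (ascPochhammer ℝ (n + 1)).eval μ * (ascPochhammer ℝ k).eval (μ + n + 1) := by
    have h := ascPochhammer_eval_add μ (n + 1) k
    rw [show n + 1 + k = n + k + 1 by ring, ascPochhammer_succ_eval] at h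
    push_cast at h
    rw [add_assoc μ, ← h]; ring
  have h6 : (n : ℝ) + k + μ ≠ 0 := by positivity
  have h7 : (k.factorial : ℝ) ≠ 0 := by positivity
  simp only [negBinomCoeff, linearizationRatio, gaussCoeff, ordinaryHypergeometricCoefficient,
    ascPochhammer_eval_add (2 * μ) n k]
  generalize (ascPochhammer ℝ n).eval (2 * μ) = A at *
  generalize (ascPochhammer ℝ (n + 1)).eval μ = B at *
  generalize (ascPochhammer ℝ k).eval (μ + n + 1) = C at *
  generalize (ascPochhammer ℝ (n + k)).eval μ = D at *
  generalize (ascPochhammer ℝ k).eval (2 * μ + n) = E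
  generalize (ascPochhammer ℝ k).eval μ = F
  field_simp
  linear_combination (-(E * F)) * h5

/-- The inner sum of the product expansion is the Gauss series of `assocLegendreP_succ`, with μ = l
+ 1 and x = a². -/
lemma tsum_negBinomCoeff_mul_linearizationRatio {μ x : ℝ} (hμ : 0 < μ) (hx : |x| < 1) (n : ℕ) :
    ∑' k, negBinomCoeff μ k * linearizationRatio μ n k * x ^ k =
      (n.factorial * (n + μ) / (ascPochhammer ℝ (n + 1)).eval μ) *
        ₂F₁ μ (2 * μ + n) (μ + n + 1) x := by
  rw [← ((hasSum_gaussCoeff (by positivity) hx).mul_left _).tsum_eq]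
  refine tsum_congr fun k => ?_
  rw [negBinomCoeff_mul_linearizationRatio hμ, mul_assoc]

lemma tanh_half_mem {r : ℝ} (hr : 0 < r) :
    0 < Real.tanh (r / 2) ∧ Real.tanh (r / 2) < 1 := by
  refine ⟨?_, Real.tanh_lt_one _⟩
  rw [Real.tanh_eq_sinh_div_cosh]
  exact div_pos (Real.sinh_pos_iff.2 (by linarith)) (Real.cosh_pos _)

lemma one_sub_tanh_half_sq (r : ℝ) :
    1 - Real.tanh (r / 2) ^ 2 = 1 / Real.cosh (r / 2) ^ 2 := by
  have h := Real.cosh_sq (r / 2)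
  have h1 := (Real.cosh_pos (r / 2)).ne'
  rw [Real.tanh_eq_sinh_div_cosh]
  field_simp
  linarith

lemma cosh_eq_tanh_half (r : ℝ) :
    Real.cosh r = (1 + Real.tanh (r / 2) ^ 2) / (1 - Real.tanh (r / 2) ^ 2) := by
  have h1 := (Real.cosh_pos (r / 2)).ne'
  rw [one_sub_tanh_half_sq, Real.tanh_eq_sinh_div_cosh]
  conv_lhs => rw [show r = 2 * (r / 2) by ring, Real.cosh_two_mul]
  field_simp

lemma sinh_eq_tanh_half (r : ℝ) :
    Real.sinh r = 2 * Real.tanh (r / 2) / (1 - Real.tanh (r / 2) ^ 2) := by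
  have h1 := (Real.cosh_pos (r / 2)).ne'
  rw [one_sub_tanh_half_sq, Real.tanh_eq_sinh_div_cosh]
  conv_lhs => rw [show r = 2 * (r / 2) by ring, Real.sinh_two_mul]
  field_simp

/-- The real factor of `Q_l^{l + n + 1}(cosh s)`. -/
noncomputable def legendreQReal (l : ℝ) (n : ℕ) (s : ℝ) : ℝ :=
  2 ^ l * Real.Gamma (l + 1) * n.factorial *
    gegenbauerC n (l + 1) (Real.cosh s / Real.sinh s) / Real.sinh s ^ (l + 1)

/-- The coefficients of the derivative of the addition formula. -/
noncomputable def additionCoeff (l r s : ℝ) (n : ℕ) : ℝ :=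
  2 * (n + (l + 1)) / (Real.sinh r * Real.sinh s) ^ l *
    (assocLegendreP l (-(l + ((n + 1 : ℕ) : ℝ))) (Real.cosh r) * legendreQReal l n s)

/-- In half-angle tangents, Z² - 1 = (Z - 1)(Z + 1) is a constant times (1 - 2(a/b)c + (a/b)²)(1 -
2abc + (ab)²), so `hasSum_product_generating` applies. The condition b + 1/b = 2y gives y = coth s,
and r < s gives a < b. -/
lemma hasSum_additionCoeff {l r s c : ℝ} (hl : 0 < l) (hr : 0 < r) (hrs : r < s)
    (hc : c ∈ Set.Icc (-1) 1) :
    HasSum (fun n => additionCoeff l r s n * gegenbauerC n (l + 1) c)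
      (Real.sinh r * Real.sinh s * (coshDist r s c ^ 2 - 1) ^ (-(l + 1))) := by
  obtain ⟨ha, ha1⟩ := tanh_half_mem hr
  obtain ⟨hb, hb1⟩ := tanh_half_mem (hr.trans hrs)
  have hab : Real.tanh (r / 2) < Real.tanh (s / 2) := by
    have h := Real.sinh_pos_iff.2 (by linarith : 0 < s / 2 - r / 2)
    rw [Real.sinh_sub] at h
    rw [Real.tanh_eq_sinh_div_cosh, Real.tanh_eq_sinh_div_cosh,
      div_lt_div_iff₀ (Real.cosh_pos _) (Real.cosh_pos _)]
    linarith
  have hS := Real.sinh_pos_iff.2 hr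
  have hT := Real.sinh_pos_iff.2 (hr.trans hrs)
  have hZ := one_lt_coshDist hr.le hrs hc.2
  have ec := cosh_eq_tanh_half r
  have es := sinh_eq_tanh_half r
  have ec' := cosh_eq_tanh_half s
  have es' := sinh_eq_tanh_half s
  set a := Real.tanh (r / 2)
  set b := Real.tanh (s / 2)
  have ha2 : 0 < 1 - a ^ 2 := by nlinarith
  have hb2 : 0 < 1 - b ^ 2 := by nlinarith
  have hy : b + b⁻¹ = 2 * (Real.cosh s / Real.sinh s) := by
    rw [ec', es']; field_simp; ring
  have hμ : 0 < l + 1 := by linarith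
  have h := hasSum_product_generating hμ hc ha hab hb1 hy
  have hax : |a ^ 2| < 1 := by rw [abs_of_nonneg (by positivity)]; nlinarith
  set K : ℝ := (Real.sinh r * Real.sinh s) * ((Real.sinh r * Real.sinh s)⁻¹ *
    (2 * a * (1 - a ^ 2) / Real.sinh s)) ^ (l + 1) with hK
  have hg : ∀ {h : ℝ}, 0 < h → h < 1 → 0 < 1 - 2 * h * c + h ^ 2 := fun {h} h0 h1 => by
    nlinarith [hc.2, mul_le_mul_of_nonneg_left hc.2 h0.le, sq_pos_of_pos (sub_pos.2 h1)]
  have hg1 := hg (div_pos ha hb) ((div_lt_one hb).2 hab)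
  have hg2 := hg (mul_pos ha hb) (by nlinarith)
  have hk : ∀ n, additionCoeff l r s n * gegenbauerC n (l + 1) c = K * (gegenbauerC n (l + 1) c *
      (gegenbauerC n (l + 1) (Real.cosh s / Real.sinh s) * (a ^ n * ∑' k : ℕ,
        negBinomCoeff (l + 1) k * linearizationRatio (l + 1) n k * (a ^ 2) ^ k))) := by
    intro n
    rw [tsum_negBinomCoeff_mul_linearizationRatio hμ hax, additionCoeff, legendreQReal,
      assocLegendreP_succ hl n ha ha1 ec, hK,
      Real.mul_rpow (x := (Real.sinh r * Real.sinh s)⁻¹) (by positivity) (by positivity),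
      Real.inv_rpow (by positivity), Real.div_rpow (by positivity) hT.le,
      Real.mul_rpow (x := 2 * a) (by positivity) ha2.le, Real.mul_rpow (by norm_num) ha.le,
      show l + 1 + (n : ℝ) + 1 = (l + 1) + ((n + 1 : ℕ) : ℝ) by push_cast; ring,
      Gamma_add_natCast hμ, Real.rpow_add_one (by positivity : Real.sinh r * Real.sinh s ≠ 0),
      Real.rpow_add_one (two_ne_zero)]
    have e1 := ascPochhammer_eval_ne_zero hμ (n + 1)
    have e2 := (Real.Gamma_pos_of_pos hμ).ne'
    have e3 := (Real.rpow_pos_of_pos (mul_pos hS hT) l).ne'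
    have e4 := (Real.rpow_pos_of_pos hT (l + 1)).ne'
    field_simp
  have hz : Real.sinh r * Real.sinh s * (coshDist r s c ^ 2 - 1) ^ (-(l + 1)) =
      K * ((1 - 2 * (a / b) * c + (a / b) ^ 2) ^ (-(l + 1)) *
        (1 - 2 * (a * b) * c + (a * b) ^ 2) ^ (-(l + 1))) := by
    rw [← Real.mul_rpow hg1.le hg2.le, hK, mul_assoc (Real.sinh r * Real.sinh s)]
    congr 1
    rw [← neg_neg (l + 1), Real.rpow_neg (by positivity) (-(l + 1)), neg_neg,
      ← Real.inv_rpow (by positivity), ← Real.mul_rpow (by positivity) (by positivity)]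
    congr 1
    rw [coshDist, ec, ec', es, es']
    field_simp
    ring
  simp only [hk, hz]
  exact h.mul_left K

/-! ### Termwise integration and the constant term -/

/-- By the Rodrigues-type relation, the integrand is a multiple of the derivative of (1 -
c²)^(l+1/2) C_n^(l+1)(c), which vanishes at both endpoints. The bound l ≥ 1/2 keeps the weight
continuous. -/
lemma integral_gegenbauerC_succ_mul_rpow {l : ℝ} (hl : 1 / 2 ≤ l) (n : ℕ) :
    ∫ c in (-1 : ℝ)..1, gegenbauerC (n + 1) l c * (1 - c ^ 2) ^ (l - 1 / 2) = 0 := by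
  have hl0 : 0 < l := by linarith
  have hw : ∀ p : ℝ, 0 ≤ p → Continuous fun c : ℝ => (1 - c ^ 2) ^ p := fun p hp =>
    (by fun_prop : Continuous fun c : ℝ => 1 - c ^ 2).rpow_const fun _ => Or.inr hp
  have h := intervalIntegral.integral_eq_sub_of_hasDerivAt_of_le (a := -1) (b := 1) (by norm_num)
    ((hw (l + 1 / 2) (by linarith)).mul (continuous_gegenbauerC n (l + 1))).continuousOn
    (fun x hx => hasDerivAt_rpow_mul_gegenbauerC hl0 n hx)
    ((continuous_const.mul ((continuous_gegenbauerC (n + 1) l).mul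
      (hw (l - 1 / 2) (by linarith)))).intervalIntegrable _ _)
  rw [intervalIntegral.integral_const_mul] at h
  have h0 : (0 : ℝ) ^ (l + 1 / 2) = 0 := Real.zero_rpow (by linarith)
  norm_num [h0] at h
  refine h.resolve_left ?_
  rintro ((h | h) | h) <;> linarith [(Nat.cast_nonneg n : (0 : ℝ) ≤ n)]

/-- Termwise integration of a Gegenbauer expansion; the constant of integration is determined by
the weighted mean. -/
lemma hasSum_gegenbauerC_succ_of_hasDerivAt {l m : ℝ} (hl : 1 / 2 ≤ l) {κ : ℕ → ℝ} {f f' : ℝ → ℝ}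
    (hsum : ∀ c ∈ Set.Icc (-1 : ℝ) 1, HasSum (fun n => κ n * gegenbauerC n (l + 1) c) (f' c))
    (hf : ∀ c ∈ Set.Icc (-1 : ℝ) 1, HasDerivAt f (f' c) c)
    (hf' : ContinuousOn f' (Set.Icc (-1) 1))
    (hm : ∫ c in (-1 : ℝ)..1, f c * (1 - c ^ 2) ^ (l - 1 / 2) =
      m * ∫ c in (-1 : ℝ)..1, (1 - c ^ 2) ^ (l - 1 / 2))
    {c : ℝ} (hc : c ∈ Set.Icc (-1 : ℝ) 1) :
    HasSum (fun n => κ n / (2 * l) * gegenbauerC (n + 1) l c) (f c - m) := by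
  have hl0 : 0 < l := by linarith
  have hμ : 0 < l + 1 := by linarith
  have huIcc : ∀ x ∈ Set.Icc (-1 : ℝ) 1, Set.uIcc x c ⊆ Set.Icc (-1) 1 := fun x hx =>
    Set.uIcc_subset_Icc hx hc
  -- Each |C_n^(l+1)| is largest at 1, so absolute convergence at that endpoint dominates the series
  -- on all of [-1, 1].
  set β : ℕ → ℝ := fun n => |κ n * gegenbauerC n (l + 1) 1| with hβ
  have hβs : Summable β := (hsum 1 (by norm_num)).summable.abs
  have hle : ∀ n, ∀ x ∈ Set.Icc (-1 : ℝ) 1, ‖κ n * gegenbauerC n (l + 1) x‖ ≤ β n := fun n x hx => by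
    rw [hβ, Real.norm_eq_abs, abs_mul]
    simp only [abs_mul]
    exact mul_le_mul_of_nonneg_left ((abs_gegenbauerC_le hμ n hx).trans (le_abs_self _))
      (abs_nonneg _)
  set g : ℕ → ℝ → ℝ := fun n x => κ n / (2 * l) * gegenbauerC (n + 1) l x with hg
  have hgc : ∀ n, Continuous (g n) := fun n => continuous_const.mul (continuous_gegenbauerC _ _)
  have hint : ∀ n x, ∫ t in x..c, κ n * gegenbauerC n (l + 1) t = g n c - g n x := fun n x => by
    refine intervalIntegral.integral_eq_sub_of_hasDerivAt (fun t _ => ?_)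
      ((continuous_const.mul (continuous_gegenbauerC _ _)).intervalIntegrable _ _)
    refine ((hasDerivAt_gegenbauerC hl0 n t).const_mul (κ n / (2 * l))).congr_deriv ?_
    field_simp
  have hdiff : ∀ x ∈ Set.Icc (-1 : ℝ) 1, HasSum (fun n => g n c - g n x) (f c - f x) := by
    intro x hx
    have h := intervalIntegral.hasSum_integral_of_dominated_convergence (μ := volume) (a := x)
      (b := c) (F := fun n t => κ n * gegenbauerC n (l + 1) t) (f := f') (fun n _ => β n)
      (fun n => (continuous_const.mul (continuous_gegenbauerC _ _)).aestronglyMeasurable)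
      (fun n => Eventually.of_forall fun t ht => hle n t (huIcc x hx (Set.uIoc_subset_uIcc ht)))
      (Eventually.of_forall fun t _ => hβs) intervalIntegrable_const
      (Eventually.of_forall fun t ht => hsum t (huIcc x hx (Set.uIoc_subset_uIcc ht)))
    rw [intervalIntegral.integral_eq_sub_of_hasDerivAt (fun t ht => hf t (huIcc x hx ht))
      ((hf'.mono (huIcc x hx)).intervalIntegrable)] at h
    simpa only [hint] using h
  have hbd : ∀ n, ∀ x ∈ Set.Icc (-1 : ℝ) 1, ‖g n c - g n x‖ ≤ β n * 2 := fun n x hx => by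
    rw [← hint]
    refine (intervalIntegral.norm_integral_le_of_norm_le_const fun t ht =>
      hle n t (huIcc x hx (Set.uIoc_subset_uIcc ht))).trans ?_
    refine mul_le_mul_of_nonneg_left ?_ (abs_nonneg _)
    rw [abs_le]
    constructor <;> linarith [hx.1, hx.2, hc.1, hc.2]
  set w : ℝ → ℝ := fun x => (1 - x ^ 2) ^ (l - 1 / 2) with hw
  have hwc : Continuous w := (by fun_prop : Continuous fun c : ℝ => 1 - c ^ 2).rpow_const
    fun _ => Or.inr (by linarith)
  have hw0 : ∀ x ∈ Set.Icc (-1 : ℝ) 1, 0 ≤ w x := fun x hx =>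
    Real.rpow_nonneg (by nlinarith [hx.1, hx.2]) _
  have huIoc : Set.uIoc (-1 : ℝ) 1 ⊆ Set.Icc (-1) 1 := by
    rw [Set.uIoc_of_le (by norm_num)]; exact Set.Ioc_subset_Icc_self
  have hW : 0 < ∫ x in (-1 : ℝ)..1, w x :=
    intervalIntegral.intervalIntegral_pos_of_pos_on (hwc.intervalIntegrable _ _)
      (fun x hx => Real.rpow_pos_of_pos (by nlinarith [hx.1, hx.2]) _) (by norm_num)
  -- Averaging the differences over x removes every `g n x` by orthogonality to constants and
  -- replaces `f x` by m. Convergence of the sum of `g n c` need not be known beforehand.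
  have h := intervalIntegral.hasSum_integral_of_dominated_convergence (μ := volume) (a := -1)
      (b := 1) (F := fun n x => (g n c - g n x) * w x) (f := fun x => (f c - f x) * w x)
      (fun n x => β n * 2 * w x)
      (fun n => ((continuous_const.sub (hgc n)).mul hwc).aestronglyMeasurable)
      (fun n => Eventually.of_forall fun x hx => by
        rw [norm_mul, Real.norm_of_nonneg (hw0 x (huIoc hx))]
        exact mul_le_mul_of_nonneg_right (hbd n x (huIoc hx)) (hw0 x (huIoc hx)))
      (Eventually.of_forall fun t _ => (hβs.mul_right 2).mul_right _)
      (by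
        simp only [tsum_mul_right]
        exact (continuous_const.mul hwc).intervalIntegrable _ _)
      (Eventually.of_forall fun x hx => (hdiff x (huIoc hx)).mul_right _)
  have hfc : ContinuousOn f (Set.Icc (-1) 1) := fun x hx =>
    (hf x hx).continuousAt.continuousWithinAt
  have e1 : ∀ n, ∫ x in (-1 : ℝ)..1, (g n c - g n x) * w x =
      g n c * ∫ x in (-1 : ℝ)..1, w x := fun n => by
    simp only [sub_mul]
    rw [intervalIntegral.integral_sub (f := fun x => g n c * w x) (g := fun x => g n x * w x)
      ((continuous_const.mul hwc).intervalIntegrable _ _)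
      (((hgc n).mul hwc).intervalIntegrable _ _), intervalIntegral.integral_const_mul]
    simp only [hg, mul_assoc, intervalIntegral.integral_const_mul]
    rw [integral_gegenbauerC_succ_mul_rpow hl n]
    ring
  have e2 : ∫ x in (-1 : ℝ)..1, (f c - f x) * w x = (f c - m) * ∫ x in (-1 : ℝ)..1, w x := by
    simp only [sub_mul]
    rw [intervalIntegral.integral_sub (f := fun x => f c * w x) (g := fun x => f x * w x)
      ((continuous_const.mul hwc).intervalIntegrable _ _)
      (ContinuousOn.intervalIntegrable (by
        rw [Set.uIcc_of_le (by norm_num : (-1 : ℝ) ≤ 1)]; exact hfc.mul hwc.continuousOn)),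
      intervalIntegral.integral_const_mul, hm]
  rw [e2] at h
  simp only [e1] at h
  exact (hasSum_mul_right_iff hW.ne').1 h

/-- The addition theorem for the fundamental solution, without its zeroth term. -/
lemma hasSum_fundIntegral {d : ℕ} (hd : 3 ≤ d) {r s c : ℝ} (hr : 0 < r) (hrs : r < s)
    (hc : c ∈ Set.Icc (-1) 1) :
    HasSum (fun n => additionCoeff ((d : ℝ) / 2 - 1) r s n / (2 * ((d : ℝ) / 2 - 1)) *
        gegenbauerC (n + 1) ((d : ℝ) / 2 - 1) c)
      (fundIntegral d (Real.arcosh (coshDist r s c)) - fundIntegral d s) := by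
  have hd' : (3 : ℝ) ≤ d := by exact_mod_cast hd
  have hexp : (d : ℝ) / 2 - 1 - 1 / 2 = ((d : ℝ) - 3) / 2 := by ring
  refine hasSum_gegenbauerC_succ_of_hasDerivAt
    (f := fun c => fundIntegral d (Real.arcosh (coshDist r s c))) (by linarith)
    (fun x hx => hasSum_additionCoeff (by linarith) hr hrs hx) (fun x hx => ?_) ?_ ?_ hc
  · refine ((hasDerivAt_fundIntegral_arcosh d hd (one_lt_coshDist hr.le hrs hx.2)).comp x
      (hasDerivAt_coshDist_right r s x)).congr_deriv ?_
    rw [sub_add_cancel]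
    ring
  · refine continuousOn_const.mul (ContinuousOn.rpow_const ?_ fun x hx => Or.inl ?_)
    · unfold coshDist
      fun_prop
    · nlinarith [one_lt_coshDist hr.le hrs hx.2]
  · rw [hexp]
    exact integral_fundIntegral_mul_weight hd hr hrs

/-! ### Assembly of the Legendre series -/

/-- The sign in each term cancels the n-dependent part of the phase of Q, so all terms share one
phase, which the prefactor of the theorem removes. -/
lemma neg_one_pow_mul_cexp (l : ℝ) (n : ℕ) :
    (-1 : ℂ) ^ n * Complex.exp (Complex.I * Real.pi * ((l + (n : ℝ) : ℝ) : ℂ)) =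
      Complex.exp (Complex.I * Real.pi * (l : ℂ)) := by
  have h : Complex.I * Real.pi * ((l + (n : ℝ) : ℝ) : ℂ) =
      Complex.I * Real.pi * (l : ℂ) + n * (Real.pi * Complex.I) := by
    push_cast; ring
  rw [h, Complex.exp_add, Complex.exp_nat_mul, Complex.exp_pi_mul_I, mul_left_comm, ← mul_pow]
  norm_num

lemma gegenbauerTerm_succ {d : ℕ} (hd : 3 ≤ d) {r r' : ℝ} (hr : 0 < r) (hr' : 0 < r') (γ : ℝ)
    (n : ℕ) :
    gegenbauerTerm d r r' γ (n + 1) =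
      Complex.exp (Complex.I * Real.pi * (((d : ℝ) / 2 - 1 : ℝ) : ℂ)) *
        ((((d : ℝ) - 2) * (Real.sinh (min r r') * Real.sinh (max r r')) ^ ((d : ℝ) / 2 - 1) : ℝ) : ℂ)
        * ((additionCoeff ((d : ℝ) / 2 - 1) (min r r') (max r r') n / (2 * ((d : ℝ) / 2 - 1)) *
          gegenbauerC (n + 1) ((d : ℝ) / 2 - 1) (Real.cos γ) : ℝ) : ℂ) := by
  have hd' : (3 : ℝ) ≤ d := by exact_mod_cast hd
  have hl : 0 < (d : ℝ) / 2 - 1 := by linarith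
  have hS : 0 < Real.sinh (min r r') := Real.sinh_pos_iff.2 (lt_min hr hr')
  have hT : 0 < Real.sinh (max r r') := Real.sinh_pos_iff.2 (hr.trans_le (le_max_left _ _))
  have hQ := assocLegendreQ_succ hl hT (Real.cosh_pos (max r r'))
    (by rw [Real.cosh_sq]; ring) n
  have hcoef : (2 * ((n + 1 : ℕ) : ℂ) + (d : ℂ) - 2) = ((2 * (n + ((d : ℝ) / 2 - 1 + 1)) : ℝ) : ℂ) := by
    push_cast; ring
  have hreal : (((d : ℝ) - 2) * (Real.sinh (min r r') * Real.sinh (max r r')) ^ ((d : ℝ) / 2 - 1)) *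
      (additionCoeff ((d : ℝ) / 2 - 1) (min r r') (max r r') n / (2 * ((d : ℝ) / 2 - 1)) *
          gegenbauerC (n + 1) ((d : ℝ) / 2 - 1) (Real.cos γ)) =
      2 * (n + ((d : ℝ) / 2 - 1 + 1)) * assocLegendreP ((d : ℝ) / 2 - 1)
        (-((d : ℝ) / 2 - 1 + ((n + 1 : ℕ) : ℝ))) (Real.cosh (min r r')) *
        legendreQReal ((d : ℝ) / 2 - 1) n (max r r') *
        gegenbauerC (n + 1) ((d : ℝ) / 2 - 1) (Real.cos γ) := by
    have h1 := (Real.rpow_pos_of_pos (mul_pos hS hT) ((d : ℝ) / 2 - 1)).ne'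
    rw [additionCoeff, show (d : ℝ) - 2 = 2 * ((d : ℝ) / 2 - 1) by ring]
    generalize (Real.sinh (min r r') * Real.sinh (max r r')) ^ ((d : ℝ) / 2 - 1) = B at *
    generalize (d : ℝ) / 2 - 1 = l at *
    field_simp
  rw [mul_assoc, ← Complex.ofReal_mul, hreal, gegenbauerTerm, hQ, hcoef,
    ← neg_one_pow_mul_cexp ((d : ℝ) / 2 - 1) (n + 1), legendreQReal]
  push_cast
  ring

/-- P_l^(-l)(cosh r) is elementary, a multiple of sinh^l r, and Q_l^l(cosh s) is a multiple of
sinh^l s · I_d(s). The term is thus the constant subtracted in `hasSum_fundIntegral`. -/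
lemma gegenbauerTerm_zero {d : ℕ} (hd : 3 ≤ d) {r r' : ℝ} (hr : 0 < r) (hr' : 0 < r') (γ : ℝ) :
    gegenbauerTerm d r r' γ 0 =
      Complex.exp (Complex.I * Real.pi * (((d : ℝ) / 2 - 1 : ℝ) : ℂ)) *
        ((((d : ℝ) - 2) * (Real.sinh (min r r') * Real.sinh (max r r')) ^ ((d : ℝ) / 2 - 1) : ℝ) : ℂ)
        * (fundIntegral d (max r r') : ℂ) := by
  have hd' : (3 : ℝ) ≤ d := by exact_mod_cast hd
  have hl : 0 < (d : ℝ) / 2 - 1 := by linarith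
  have hS : 0 < Real.sinh (min r r') := Real.sinh_pos_iff.2 (lt_min hr hr')
  have hm : 0 < max r r' := hr.trans_le (le_max_left _ _)
  have hT : 0 < Real.sinh (max r r') := Real.sinh_pos_iff.2 hm
  obtain ⟨ha, ha1⟩ := tanh_half_mem (lt_min hr hr')
  have hP := assocLegendreP_zero (l := (d : ℝ) / 2 - 1) ha ha1 (cosh_eq_tanh_half (min r r'))
  have hsin := sinh_eq_tanh_half (min r r')
  have hS2 : Real.tanh (min r r' / 2) / (1 - Real.tanh (min r r' / 2) ^ 2) =
      Real.sinh (min r r') / 2 := by rw [hsin]; ring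
  rw [hS2, sub_add_cancel] at hP
  have hG := (Real.Gamma_pos_of_pos (by linarith : 0 < (d : ℝ) / 2)).ne'
  have hreal : (((d : ℝ) - 2) * (Real.sinh (min r r') * Real.sinh (max r r')) ^ ((d : ℝ) / 2 - 1)) *
      fundIntegral d (max r r') = ((d : ℝ) - 2) * assocLegendreP ((d : ℝ) / 2 - 1)
        (-((d : ℝ) / 2 - 1)) (Real.cosh (min r r')) * (2 ^ ((d : ℝ) / 2 - 1) *
          Real.Gamma ((d : ℝ) / 2) * Real.sinh (max r r') ^ ((d : ℝ) / 2 - 1) *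
          fundIntegral d (max r r')) := by
    rw [hP, Real.mul_rpow hS.le hT.le, Real.div_rpow hS.le zero_le_two]
    field_simp
  rw [mul_assoc, ← Complex.ofReal_mul, hreal, gegenbauerTerm, gegenbauerC_zero]
  simp only [Nat.cast_zero, add_zero]
  rw [assocLegendreQ_zero d hd hm]
  push_cast
  ring

/-- The addition theorem for the fundamental solution. -/
lemma hasSum_gegenbauerTerm {d : ℕ} (hd : 3 ≤ d) {r r' : ℝ} (hr : 0 < r) (hr' : 0 < r')
    (hne : r ≠ r') (γ : ℝ) :
    HasSum (gegenbauerTerm d r r' γ)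
      (Complex.exp (Complex.I * Real.pi * (((d : ℝ) / 2 - 1 : ℝ) : ℂ)) *
        ((((d : ℝ) - 2) * (Real.sinh r * Real.sinh r') ^ ((d : ℝ) / 2 - 1) : ℝ) : ℂ)
        * (fundIntegral d (Real.arcosh (coshDist r r' (Real.cos γ))) : ℂ)) := by
  have h := hasSum_fundIntegral hd (lt_min hr hr') (min_lt_max.2 hne)
    ⟨Real.neg_one_le_cos γ, Real.cos_le_one γ⟩
  have e1 : Real.sinh r * Real.sinh r' = Real.sinh (min r r') * Real.sinh (max r r') := by
    rcases le_total r r' with h | h <;> simp [h, mul_comm]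
  have e2 : coshDist r r' (Real.cos γ) = coshDist (min r r') (max r r') (Real.cos γ) := by
    rcases le_total r r' with h | h <;> simp [h, coshDist, mul_comm]
  rw [← hasSum_nat_add_iff' 1, sum_range_one, gegenbauerTerm_zero hd hr hr', e1, e2, ← mul_sub,
    ← Complex.ofReal_sub]
  simp only [gegenbauerTerm_succ hd hr hr']
  exact (Complex.hasSum_ofReal.2 h).mul_left _

lemma hypRho_geodesicPolar {d : ℕ} {R : ℝ} (hR : R ≠ 0) (r r' : ℝ)
    {ω ω' : EuclideanSpace ℝ (Fin d)} (hω : ‖ω‖ = 1) (hω' : ‖ω'‖ = 1) :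
    hypRho R (geodesicPolar R r ω) (geodesicPolar R r' ω') =
      Real.arcosh (coshDist r r' (Real.cos (InnerProductGeometry.angle ω ω'))) := by
  have hin : Real.cos (InnerProductGeometry.angle ω ω') = ∑ i, ω i * ω' i := by
    rw [InnerProductGeometry.cos_angle, hω, hω', mul_one, div_one, PiLp.inner_apply]
    exact sum_congr rfl fun i _ => by simp [mul_comm]
  rw [hypRho, minkowskiForm, coshDist, hin, mul_sum]
  simp only [geodesicPolar, Fin.cons_zero, Fin.cons_succ]
  congr 2
  · field_simp
  · exact sum_congr rfl fun i _ => by field_simp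

end

theorem mainTheorem1 (d : ℕ) (hd : 3 ≤ d) (R : ℝ) (hR : 0 < R)
    (x x' : Fin (d + 1) → ℝ) (hx : x ∈ hyperboloid d R) (hx' : x' ∈ hyperboloid d R)
    (r r' : ℝ) (hr : 0 < r) (hr' : 0 < r') (hrr' : r ≠ r')
    (ω ω' : EuclideanSpace ℝ (Fin d)) (hω : ‖ω‖ = 1) (hω' : ‖ω'‖ = 1)
    (hxω : x = geodesicPolar R r ω) (hxω' : x' = geodesicPolar R r' ω') :
    Summable (gegenbauerTerm d r r' (InnerProductGeometry.angle ω ω')) ∧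
    (fundSol d R x x' : ℂ) =
      ((Real.Gamma ((d : ℝ) / 2) : ℂ) *
          Complex.exp (-(Complex.I * Real.pi * ((d : ℂ) / 2 - 1))) /
        ((2 * Real.pi ^ ((d : ℝ) / 2) * R ^ (d - 2) * ((d : ℝ) - 2) *
          (Real.sinh r * Real.sinh r') ^ ((d : ℝ) / 2 - 1) : ℝ) : ℂ)) *
        ∑' l : ℕ, gegenbauerTerm d r r' (InnerProductGeometry.angle ω ω') l := by
  have h := hasSum_gegenbauerTerm hd hr hr' hrr' (InnerProductGeometry.angle ω ω')
  -- In ℂ, unconditional summability is equivalent to absolute convergence.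
  refine ⟨h.summable, ?_⟩
  have hd' : (3 : ℝ) ≤ d := by exact_mod_cast hd
  have h1 : (d : ℝ) - 2 ≠ 0 := by linarith
  have h2 : (Real.sinh r * Real.sinh r') ^ ((d : ℝ) / 2 - 1) ≠ 0 :=
    (Real.rpow_pos_of_pos (mul_pos (Real.sinh_pos_iff.2 hr) (Real.sinh_pos_iff.2 hr')) _).ne'
  have h3 : Real.pi ^ ((d : ℝ) / 2) ≠ 0 := (Real.rpow_pos_of_pos Real.pi_pos _).ne'
  have h4 := Complex.exp_ne_zero (Complex.I * Real.pi * (((d : ℝ) / 2 - 1 : ℝ) : ℂ))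
  have h5 : Complex.I * Real.pi * ((d : ℂ) / 2 - 1) =
      Complex.I * Real.pi * (((d : ℝ) / 2 - 1 : ℝ) : ℂ) := by push_cast; ring
  rw [h.tsum_eq, hxω, hxω', fundSol, hypRho_geodesicPolar hR.ne' r r' hω hω', h5, Complex.exp_neg]
  generalize Complex.exp (Complex.I * Real.pi * (((d : ℝ) / 2 - 1 : ℝ) : ℂ)) = e at *
  generalize (Real.sinh r * Real.sinh r') ^ ((d : ℝ) / 2 - 1) = B at *
  generalize fundIntegral d _ = J
  generalize Real.pi ^ ((d : ℝ) / 2) = p at *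
  generalize (d : ℝ) - 2 = m at *
  have hR' : (R : ℂ) ≠ 0 := Complex.ofReal_ne_zero.2 hR.ne'
  have hB : (B : ℂ) ≠ 0 := Complex.ofReal_ne_zero.2 h2
  have hp : (p : ℂ) ≠ 0 := Complex.ofReal_ne_zero.2 h3
  have hm : (m : ℂ) ≠ 0 := Complex.ofReal_ne_zero.2 h1
  push_cast
  field_simp
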